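/- Let $k$ be a field and let $N\hookrightarrow M$ be an extension of (associative, unital, not necessarily commutative) $k$-algebras. Suppose it is a *Markov extension*: there are an $N$-bimodule map $E:M\to N$, finitely many $x_i,y_i\in M$ and $0\ne\lambda\in k$ with $\sum_i E(mx_i)y_i=m=\sum_i x_iE(y_im)$ for all $m\in M$, $E(1)=1$, $\sum_i x_iy_i=\lambda^{-1}1$, and a trace $T:N\to k$ with $T(1)=1$ such that $T_0=T\circ E$ is a trace on $M$. Let $U=C_M(N)$ be the centralizer of $N$ in $M$. Assume moreover: * (symmetric) $E(um)=E(mu)$ for all $u\in U$, $m\in M$; * (symmetric product) $\sum_i x_iy_i=\sum_i y_ix_i=\lambda^{-1}1$; * (weakly irreducible) $U$ is Kanzaki separable, i.e. there is $f=f^{(1)}\otimes f^{(2)}\in U\otimes_k U$ with $uf=fu$ for all $u \in U$, $f^{(1)}f^{(2)}=1$ and $f^{(2)}\otimes f^{(1)}=f$, and $T_0|_U$ is non-degenerate. Let $M_1=\mathrm{End}(M_N)\cong M\otimes_N M$, containing $M$ by left multiplication, with Jones idempotent $e_1=E$ and conditional expectation $E_M:M_1\to M$, $E_M(me_1m')=\lambda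 mm'$; it is an extension of $M$ with dual bases $\lambda^{-1}x_ie_1$, $e_1y_i$ and the same $\lambda$. Iterating, let $M_2=\mathrm{End}((M_1)_M)$ with $e_2=E_M$ and $E_{M_1}:M_2\to M_1$. Put $T_1=T\circ E\circ E_M$, $T_2=T_1\circ E_{M_1}$, $A=C_{M_1}(N)$, $B=C_{M_2}(M)$, $V=C_{M_1}(M)$. Assume the *weak depth 2 property*: $E_M$ has finite dual bases in $A$ and $E_{M_1}$ has finite dual bases in $B$. Let $f$ be the symmetric separability element of $V$ and $w=(f^{(1)}T_1(f^{(2)}))^{-1}\in V$. Then the pairing $\langle a,b\rangle=\lambda^{-2}T_2(ae_2e_1wb)$ of $A$ and $B$ is non-degenerate, and $A$ carries a unique weak Hopf algebra structure with $$\langle a,bb'\rangle=\langle a_{(1)},b\rangle\langle a_{(2)},b'\rangle,\qquad \varepsilon(a)=\langle a,1\rangle,\qquad \langle S(a),b\rangle=\langle a,S_B(b)\rangle,$$ where $S_B:B\to B$ is the linear map determined by $\langle a,b\rangle=\lambda^{-2}T_2(S_B(b)e_1e_2wa)$ for all $a\in A$, $b\in B$. For $a\in A$, $m\in M$ the element $$a\triangleright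 m=a_{(1)}\,m\,S(a_{(2)})$$ of $M_1$ lies in $M$, this makes $M$ a left $A$-module algebra (that is, $\triangleright$ is a left $A$-module structure on $M$ with $a\triangleright(mm')=(a_{(1)}\triangleright m)(a_{(2)}\triangleright m')$ and $a\triangleright1=\varepsilon_t(a)\triangleright1$), and $$N=M^A:=\{m\in M\mid a\triangleright m=\varepsilon_t(a)\triangleright m\ \text{ for all }a\in A\},$$ where $\varepsilon_t(a)=(\varepsilon\otimes\mathrm{id})(\Delta(1)(a\otimes1))$. -/

import Mathlib

open scoped TensorProduct

noncomputable section

/-! ## Weak Hopf algebras and their actions -/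

/-- A weak Hopf algebra over `k` (Böhm–Nill–Szlachányi). -/
class WeakHopfAlgebra (k : Type*) (H : Type*) [Field k] [Semiring H] [Algebra k H]
    extends Coalgebra k H where
  /-- `Δ(hg) = Δ(h)Δ(g)` -/
  comul_mul : ∀ h g : H, comul (h * g) = comul h * comul g
  /-- `ε(hgf) = ε(h g₁) ε(g₂ f)` -/
  counit_mul_mul : ∀ h g f : H, counit (h * g * f) =
    LinearMap.mul' k k (TensorProduct.map (counit ∘ₗ LinearMap.mulLeft k h)
      (counit ∘ₗ LinearMap.mulRight k f) (comul g))
  /-- `ε(hgf) = ε(h g₂) ε(g₁ f)` -/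
  counit_mul_mul' : ∀ h g f : H, counit (h * g * f) =
    LinearMap.mul' k k (TensorProduct.map (counit ∘ₗ LinearMap.mulRight k f)
      (counit ∘ₗ LinearMap.mulLeft k h) (comul g))
  /-- `(Δ ⊗ id)Δ(1) = (Δ(1) ⊗ 1)(1 ⊗ Δ(1))` -/
  comul_comul_one : TensorProduct.assoc k H H H (comul.rTensor H (comul 1)) =
    TensorProduct.assoc k H H H (comul 1 ⊗ₜ[k] 1) * (1 ⊗ₜ[k] comul 1)
  /-- `(Δ ⊗ id)Δ(1) = (1 ⊗ Δ(1))(Δ(1) ⊗ 1)` -/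
  comul_comul_one' : TensorProduct.assoc k H H H (comul.rTensor H (comul 1)) =
    (1 ⊗ₜ[k] comul 1) * TensorProduct.assoc k H H H (comul 1 ⊗ₜ[k] 1)
  /-- the antipode -/
  antipode : H →ₗ[k] H
  /-- `h₁ S(h₂) = (ε ⊗ id)(Δ(1)(h ⊗ 1))` -/
  mul_antipode : ∀ h : H, LinearMap.mul' k H (antipode.lTensor H (comul h)) =
    TensorProduct.lid k H (counit.rTensor H (comul 1 * (h ⊗ₜ[k] 1)))
  /-- `S(h₁) h₂ = (id ⊗ ε)((1 ⊗ h)Δ(1))` -/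
  antipode_mul : ∀ h : H, LinearMap.mul' k H (antipode.rTensor H (comul h)) =
    TensorProduct.rid k H (counit.lTensor H ((1 ⊗ₜ[k] h) * comul 1))
  /-- `S(h₁) h₂ S(h₃) = S(h)` -/
  antipode_mul_antipode : ∀ h : H,
    LinearMap.mul' k H (TensorProduct.map antipode
      (LinearMap.mul' k H ∘ₗ antipode.lTensor H ∘ₗ comul) (comul h)) = antipode h

namespace WeakHopfAlgebra

variable (k : Type*) {H : Type*} [Field k] [Semiring H] [Algebra k H] [WeakHopfAlgebra k H]

/-- The target counital map `ε_t(h) = (ε ⊗ id)(Δ(1)(h ⊗ 1))`. -/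
def targetCounit (h : H) : H :=
  TensorProduct.lid k H
    ((Coalgebra.counit (R := k) (A := H)).rTensor H (Coalgebra.comul (R := k) 1 * (h ⊗ₜ[k] 1)))

variable {k} {R : Type*} [Semiring R] [Algebra k R]

/-- `act` makes the algebra `R` a left `H`-module algebra: it is a left module structure with
`h · (ab) = (h₁ · a)(h₂ · b)` and `h · 1 = ε_t(h) · 1`. -/
structure IsModuleAlgebra (act : H →ₗ[k] R →ₗ[k] R) : Prop where
  one_act : ∀ a : R, act 1 a = a
  mul_act : ∀ (h g : H) (a : R), act (h * g) a = act h (act g a)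
  act_mul : ∀ (h : H) (a b : R), act h (a * b) =
    LinearMap.mul' k R (TensorProduct.map (act.flip a) (act.flip b) (Coalgebra.comul h))
  act_one : ∀ h : H, act h 1 = act (targetCounit k h) 1

/-- The invariants `R^H = {a | h · a = ε_t(h) · a for all h}`. -/
def invariants (act : H →ₗ[k] R →ₗ[k] R) : Set R :=
  {a | ∀ h : H, act h a = act (targetCounit k h) a}

end WeakHopfAlgebra

/-! ## Separability -/

/-- A symmetric separability element of `A`: an element `f = f₁ ⊗ f₂` of `A ⊗ A` with `a f = f a`
for all `a` (outer bimodule structure), `f₁ f₂ = 1` and `f₂ ⊗ f₁ = f₁ ⊗ f₂`. -/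
structure IsSymmetricSeparabilityElement (k : Type*) {A : Type*} [Field k] [Semiring A] [Algebra k A]
    (f : A ⊗[k] A) : Prop where
  casimir : ∀ a : A, (a ⊗ₜ[k] 1) * f = f * (1 ⊗ₜ[k] a)
  mul_eq_one : LinearMap.mul' k A f = 1
  symm : TensorProduct.comm k A A f = f

/-- Kanzaki separable algebras. -/
def IsKanzakiSeparable (k A : Type*) [Field k] [Semiring A] [Algebra k A] : Prop :=
  ∃ f : A ⊗[k] A, IsSymmetricSeparabilityElement k f

open Classical in
/-- The symmetric separability element of a Kanzaki separable algebra (it is unique; the value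
is `0` for an algebra that is not Kanzaki separable). -/
def symmetricSeparabilityElement (k A : Type*) [Field k] [Semiring A] [Algebra k A] : A ⊗[k] A :=
  if h : IsKanzakiSeparable k A then h.choose else 0

/-! ## The basic construction -/

section BasicConstruction

variable {k S R : Type*} [Field k] [Semiring S] [Algebra k S] [Semiring R] [Algebra k R]

/-- The endomorphism algebra `End(R_S)` of right `S`-linear endomorphisms of `R`, for an algebra
extension `ι : S → R`. -/
def rightEnd (ι : S →ₐ[k] R) : Subalgebra k (Module.End k R) where
  carrier := {f | ∀ (r : R) (s : S), f (r * ι s) = f r * ι s}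
  mul_mem' := by
    intro f g hf hg r s
    simp only [Set.mem_ofPred_eq] at hf hg
    simp [hf, hg]
  add_mem' := by
    intro f g hf hg r s
    simp only [Set.mem_ofPred_eq] at hf hg
    simp [hf, hg, add_mul]
  algebraMap_mem' := by
    intro c r s
    simp [Module.algebraMap_end_apply]

/-- The left regular representation `R → End(R_S)`. -/
def leftReg (ι : S →ₐ[k] R) : R →ₐ[k] rightEnd ι :=
  (Algebra.lmul k R).codRestrict (rightEnd ι) (by
    intro a r s
    simp [mul_assoc])

theorem leftReg_apply (ι : S →ₐ[k] R) (a r : R) : (leftReg ι a : Module.End k R) r = a * r := rfl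

/-- The coordinates of a strongly separable extension `ι : S → R`: a bimodule map `E : R → S`,
finite dual bases `x`, `y`, with `E(1) = 1` and `∑ xᵢ yᵢ = λ⁻¹ 1`, where `λ ≠ 0` in `k`. -/
structure StronglySeparable (ι : S →ₐ[k] R) where
  /-- the conditional expectation -/
  E : R →ₗ[k] S
  /-- the number of elements of the dual bases -/
  n : ℕ
  /-- first dual basis -/
  x : Fin n → R
  /-- second dual basis -/
  y : Fin n → R
  /-- the reciprocal of the index -/
  lam : k
  lam_ne_zero : lam ≠ 0
  bimodule : ∀ (s t : S) (r : R), E (ι s * r * ι t) = s * E r * t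
  dual_left : ∀ r : R, ∑ i, ι (E (r * x i)) * y i = r
  dual_right : ∀ r : R, ∑ i, x i * ι (E (y i * r)) = r
  E_one : E 1 = 1
  index : ∑ i, x i * y i = algebraMap k R lam⁻¹

namespace StronglySeparable

variable {ι : S →ₐ[k] R} (D : StronglySeparable ι)

theorem E_mul_right (r : R) (s : S) : D.E (r * ι s) = D.E r * s := by
  simpa using D.bimodule 1 s r

theorem E_ι (s : S) : D.E (ι s) = s := by
  simpa [D.E_one] using D.bimodule 1 s 1

/-- The Jones idempotent `e`, i.e. `E` as an element of `End(R_S)`. -/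
def jones : rightEnd ι :=
  ⟨ι.toLinearMap ∘ₗ D.E, by
    intro r s
    simp [D.E_mul_right]⟩

theorem jones_apply (r : R) : (D.jones : Module.End k R) r = ι (D.E r) := rfl

theorem rightEnd_expand (f : rightEnd ι) (r : R) :
    ∑ i, (f : Module.End k R) (D.x i) * ι (D.E (D.y i * r)) = (f : Module.End k R) r := by
  conv_rhs => rw [← D.dual_right r, map_sum]
  exact Finset.sum_congr rfl fun i _ => (f.2 _ _).symm

/-- The conditional expectation `E_R : End(R_S) → R`, `E_R(f) = λ ∑ f(xᵢ) yᵢ`; it is the map with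
`E_R(a e b) = λ a b` for `a, b ∈ R`. -/
def expectation : rightEnd ι →ₗ[k] R :=
  D.lam • ∑ i, LinearMap.mulRight k (D.y i) ∘ₗ LinearMap.applyₗ (D.x i) ∘ₗ
    (rightEnd ι).val.toLinearMap

theorem expectation_apply (f : rightEnd ι) :
    D.expectation f = D.lam • ∑ i, (f : Module.End k R) (D.x i) * D.y i := by
  simp [expectation]

theorem expectation_mul_jones_mul (a b : R) :
    D.expectation (leftReg ι a * D.jones * leftReg ι b) = D.lam • (a * b) := by
  rw [expectation_apply]
  congr 1
  have h : ∀ i, ((leftReg ι a * D.jones * leftReg ι b : rightEnd ι) : Module.End k R) (D.x i) =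
      a * ι (D.E (b * D.x i)) := fun i => rfl
  simp only [h]
  simp only [mul_assoc, ← Finset.mul_sum, D.dual_left]

/-- The basic construction: `End(R_S)` is a strongly separable extension of `R` of the same index,
with dual bases `λ⁻¹ xᵢ e` and `e yᵢ`. -/
def basic : StronglySeparable (leftReg ι) where
  E := D.expectation
  n := D.n
  x i := D.lam⁻¹ • (leftReg ι (D.x i) * D.jones)
  y i := D.jones * leftReg ι (D.y i)
  lam := D.lam
  lam_ne_zero := D.lam_ne_zero
  bimodule := by
    intro s t f
    simp only [expectation_apply]
    have h : ∀ i, ((leftReg ι s * f * leftReg ι t : rightEnd ι) : Module.End k R) (D.x i) =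
        s * (f : Module.End k R) (t * D.x i) := fun i => rfl
    simp only [h]
    simp only [mul_assoc, ← Finset.mul_sum, mul_smul_comm, smul_mul_assoc]
    congr 2
    have h2 : ∀ i, (f : Module.End k R) (t * D.x i) * D.y i =
        ∑ j, (f : Module.End k R) (D.x j) * (ι (D.E (D.y j * t * D.x i)) * D.y i) := by
      intro i
      rw [← D.rightEnd_expand f (t * D.x i), Finset.sum_mul]
      simp only [mul_assoc]
    simp only [h2]
    rw [Finset.sum_comm]
    simp only [← Finset.mul_sum]
    simp only [D.dual_left]
    rw [Finset.sum_mul]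
    simp only [mul_assoc]
  dual_left := by
    intro f
    have h : ∀ i, D.expectation (f * (D.lam⁻¹ • (leftReg ι (D.x i) * D.jones))) =
        (f : Module.End k R) (D.x i) := by
      intro i
      rw [mul_smul_comm, map_smul, expectation_apply, smul_smul,
        inv_mul_cancel₀ D.lam_ne_zero, one_smul]
      have h1 : ∀ j, ((f * (leftReg ι (D.x i) * D.jones) : rightEnd ι) : Module.End k R) (D.x j)
          = (f : Module.End k R) (D.x i) * ι (D.E (D.x j)) := fun j => f.2 _ _
      simp only [h1]
      simp only [mul_assoc, ← Finset.mul_sum]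
      have := D.dual_left 1
      simp only [one_mul] at this
      rw [this, mul_one]
    simp only [h]
    apply Subtype.ext
    apply LinearMap.ext
    intro r
    rw [AddSubmonoidClass.coe_finsetSum, LinearMap.sum_apply, ← D.rightEnd_expand f r]
    rfl
  dual_right := by
    intro f
    apply Subtype.ext
    apply LinearMap.ext
    intro r
    rw [AddSubmonoidClass.coe_finsetSum, LinearMap.sum_apply]
    have h : ∀ i, ((D.lam⁻¹ • (leftReg ι (D.x i) * D.jones) *
        leftReg ι (D.expectation (D.jones * leftReg ι (D.y i) * f)) : rightEnd ι) :
          Module.End k R) r = ∑ j, D.x i * ι (D.E (D.y i * (f : Module.End k R) (D.x j))) *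
            ι (D.E (D.y j * r)) := by
      intro i
      have h1 : ((D.lam⁻¹ • (leftReg ι (D.x i) * D.jones) *
        leftReg ι (D.expectation (D.jones * leftReg ι (D.y i) * f)) : rightEnd ι) :
          Module.End k R) r = D.lam⁻¹ • (D.x i * ι (D.E
            (D.expectation (D.jones * leftReg ι (D.y i) * f) * r))) := rfl
      have h2 : ∀ j, ((D.jones * leftReg ι (D.y i) * f : rightEnd ι) : Module.End k R) (D.x j) =
          ι (D.E (D.y i * (f : Module.End k R) (D.x j))) := fun j => rfl
      rw [h1, expectation_apply]
      simp only [h2, smul_mul_assoc, map_smul, mul_smul_comm, smul_smul,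
        inv_mul_cancel₀ D.lam_ne_zero, one_smul, Finset.sum_mul, map_sum, Finset.mul_sum]
      refine Finset.sum_congr rfl fun j _ => ?_
      have := D.bimodule (D.E (D.y i * (f : Module.End k R) (D.x j))) 1 (D.y j * r)
      simp only [map_one, mul_one] at this
      rw [mul_assoc (ι _), this, map_mul, mul_assoc]
    simp only [h]
    rw [Finset.sum_comm]
    simp only [← Finset.sum_mul, D.dual_right, D.rightEnd_expand]
  E_one := by
    rw [expectation_apply]
    have h : ∀ i, ((1 : rightEnd ι) : Module.End k R) (D.x i) = D.x i := fun i => rfl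
    simp only [h, D.index, Algebra.smul_def, ← map_mul,
      mul_inv_cancel₀ D.lam_ne_zero, map_one]
  index := by
    apply Subtype.ext
    apply LinearMap.ext
    intro r
    rw [AddSubmonoidClass.coe_finsetSum, LinearMap.sum_apply]
    have h : ∀ i, ((D.lam⁻¹ • (leftReg ι (D.x i) * D.jones) *
        (D.jones * leftReg ι (D.y i)) : rightEnd ι) : Module.End k R) r =
          D.lam⁻¹ • (D.x i * ι (D.E (ι (D.E (D.y i * r))))) := fun i => rfl
    simp only [h, D.E_ι, ← Finset.smul_sum, D.dual_right]
    rfl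

/-- The centralizer `C_R(S)`. -/
def centralizer (ι : S →ₐ[k] R) : Subalgebra k R :=
  Subalgebra.centralizer k (Set.range ι)

/-- `T : S → k` is a Markov trace: a trace with `T(1) = 1` such that `T ∘ E` is a trace. -/
structure IsMarkovTrace (T : S →ₗ[k] k) : Prop where
  trace : ∀ s t : S, T (s * t) = T (t * s)
  map_one : T 1 = 1
  trace_comp : ∀ a b : R, T (D.E (a * b)) = T (D.E (b * a))

/-- `E(ua) = E(au)` for `u` in the centralizer `C_R(S)` and `a ∈ R`. -/
def IsSymmetric : Prop :=
  ∀ u ∈ centralizer ι, ∀ a : R, D.E (u * a) = D.E (a * u)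

/-- The symmetric product property `∑ xᵢ yᵢ = ∑ yᵢ xᵢ = λ⁻¹ 1`. -/
def HasSymmetricProduct : Prop :=
  ∑ i, D.x i * D.y i = algebraMap k R D.lam⁻¹ ∧ ∑ i, D.y i * D.x i = algebraMap k R D.lam⁻¹

/-- Weak irreducibility: `U = C_R(S)` is Kanzaki separable and the trace `T ∘ E` is
non-degenerate on `U`. -/
def IsWeaklyIrreducible (T : S →ₗ[k] k) : Prop :=
  IsKanzakiSeparable k (centralizer ι) ∧
    ∀ u ∈ centralizer ι, (∀ v ∈ centralizer ι, T (D.E (u * v)) = 0) → u = 0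

/-- `E` has finite dual bases in the subalgebra `A` of `R`. -/
def HasDualBasesIn (A : Subalgebra k R) : Prop :=
  ∃ (m : ℕ) (z w : Fin m → R), (∀ j, z j ∈ A) ∧ (∀ j, w j ∈ A) ∧
    (∀ r : R, ∑ j, ι (D.E (r * z j)) * w j = r) ∧ (∀ r : R, ∑ j, z j * ι (D.E (w j * r)) = r)

end StronglySeparable

end BasicConstruction

/-! ## The Jones tower `N → M → M₁ → M₂` -/

namespace StronglySeparable

variable {k N M : Type*} [Field k] [Semiring N] [Algebra k N] [Semiring M] [Algebra k M]
  (ι : N →ₐ[k] M)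

/-- `M₁ = End(M_N)` -/
abbrev M₁ : Type _ := rightEnd ι

/-- `M₂ = End((M₁)_M)` -/
abbrev M₂ : Type _ := rightEnd (leftReg ι)

/-- The inclusion `M → M₁`. -/
abbrev incl₁ : M →ₐ[k] M₁ ι := leftReg ι

/-- The inclusion `M₁ → M₂`. -/
abbrev incl₂ : M₁ ι →ₐ[k] M₂ ι := leftReg (leftReg ι)

/-- `A = C_{M₁}(N)` -/
abbrev A : Subalgebra k (M₁ ι) := centralizer ((incl₁ ι).comp ι)

/-- `B = C_{M₂}(M)` -/
abbrev B : Subalgebra k (M₂ ι) := centralizer ((incl₂ ι).comp (incl₁ ι))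

/-- `V = C_{M₁}(M)` -/
abbrev V : Subalgebra k (M₁ ι) := centralizer (incl₁ ι)

variable {ι} (D : StronglySeparable ι) (T : N →ₗ[k] k)

/-- The weak depth 2 property: `E_M : M₁ → M` has dual bases in `A` and `E_{M₁} : M₂ → M₁` has
dual bases in `B`. -/
def HasWeakDepthTwo : Prop :=
  D.basic.HasDualBasesIn (A ι) ∧ D.basic.basic.HasDualBasesIn (B ι)

/-- `T₁ = T ∘ E ∘ E_M` on `M₁` -/
def T₁ : M₁ ι →ₗ[k] k := T ∘ₗ D.E ∘ₗ D.basic.E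

/-- `T₂ = T ∘ E ∘ E_M ∘ E_{M₁}` on `M₂` -/
def T₂ : M₂ ι →ₗ[k] k := T ∘ₗ D.E ∘ₗ D.basic.E ∘ₗ D.basic.basic.E

/-- The first Jones idempotent, as an element of `M₂`. -/
def e₁ : M₂ ι := incl₂ ι D.jones

/-- The second Jones idempotent. -/
def e₂ : M₂ ι := D.basic.jones

/-- `w = (f₁ T₁(f₂))⁻¹ ∈ V`, with `f = f₁ ⊗ f₂` the symmetric separability element of `V`. -/
def weight : V ι :=
  Ring.inverse (TensorProduct.rid k (V ι)
    (((D.T₁ T) ∘ₗ (V ι).val.toLinearMap).lTensor (V ι) (symmetricSeparabilityElement k (V ι))))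

/-- `w` as an element of `M₂`. -/
def w : M₂ ι := incl₂ ι (D.weight T : M₁ ι)

/-- The pairing `⟨a, b⟩ = λ⁻² T₂(a e₂ e₁ w b)`. -/
def pairing : A ι →ₗ[k] B ι →ₗ[k] k :=
  (D.lam⁻¹ ^ 2) • ((LinearMap.mul k (M₂ ι)).compr₂ (D.T₂ T)).compl₁₂
    (LinearMap.mulRight k (D.e₂ * D.e₁ * D.w T) ∘ₗ (incl₂ ι).toLinearMap ∘ₗ (A ι).val.toLinearMap)
    (B ι).val.toLinearMap

theorem pairing_apply (a : A ι) (b : B ι) : D.pairing T a b =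
    D.lam⁻¹ ^ 2 * D.T₂ T (incl₂ ι (a : M₁ ι) * D.e₂ * D.e₁ * D.w T * (b : M₂ ι)) := by
  simp [pairing, mul_assoc]

/-- `S` is the antipode of `B`: `⟨a, b⟩ = λ⁻² T₂(S(b) e₁ e₂ w a)` for all `a`, `b`. -/
def IsAntipodeB (S : B ι →ₗ[k] B ι) : Prop :=
  ∀ (a : A ι) (b : B ι), D.pairing T a b =
    D.lam⁻¹ ^ 2 * D.T₂ T ((S b : M₂ ι) * D.e₁ * D.e₂ * D.w T * incl₂ ι (a : M₁ ι))

/-- The weak Hopf algebra structure on `A` is the one that is dual to `B` under the pairing: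
`⟨a, b b'⟩ = ⟨a₁, b⟩ ⟨a₂, b'⟩`, `ε(a) = ⟨a, 1⟩` and `⟨S_A(a), b⟩ = ⟨a, S_B(b)⟩`. -/
structure IsDualStructure (H : WeakHopfAlgebra k (A ι)) : Prop where
  comul : ∀ (a : A ι) (b b' : B ι), D.pairing T a (b * b') =
    LinearMap.mul' k k (TensorProduct.map ((D.pairing T).flip b) ((D.pairing T).flip b')
      (Coalgebra.comul a))
  counit : ∀ a : A ι, Coalgebra.counit (R := k) a = D.pairing T a 1
  antipode : ∃ S : B ι →ₗ[k] B ι, D.IsAntipodeB T S ∧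
    ∀ (a : A ι) (b : B ι), D.pairing T (H.antipode a) b = D.pairing T a (S b)

variable (ι) in
/-- The element `a₁ m S(a₂)` of `M₁`, for `a ∈ A` and `m ∈ M`. -/
def adjointAct [H : WeakHopfAlgebra k (A ι)] (a : A ι) (m : M) : M₁ ι :=
  LinearMap.mul' k (M₁ ι) (TensorProduct.map
    (LinearMap.mulRight k (incl₁ ι m) ∘ₗ (A ι).val.toLinearMap)
    ((A ι).val.toLinearMap ∘ₗ H.antipode) (Coalgebra.comul a))

end StronglySeparable

end

/-! Everything is transported to bimodule endomorphisms of `M`. An element `a` of `A` is an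
`N`-bimodule map `m ↦ a(m)` (`ap`), and the asserted action turns out to be this evaluation. The
tensor `∑ xᵢ ⊗ yᵢ` is central over `N`, so every `a` has an adjoint `â` with `E(â(m) x) = E(m a(x))`
(`hat`), which can be moved through the dual bases (`sum_apply_mul`). The functional `τ`, the
restriction of `T₁` to `A`, is a trace invariant under `hat`; depth two and weak irreducibility make
it non-degenerate, and `A` is finite-dimensional.

Write `f = ∑ p ⊗ q` for the separability element of `U`, put `z = ∑ p T₀(q)` and let `h` be its
inverse; then `w` is right multiplication by `h`. Since `M₁ = M e₁ M`, an element `b` of `B` is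
determined by `b(e₁) ∈ A`, which can be arbitrary. Under `B ≅ A` the product of `B` becomes the
convolution `∑ a(m xᵢ) b(yᵢ)` with unit `e₁`, and the pairing becomes `∑ T₀(a(xᵢ) b(yᵢ) h) = λ⁻¹ τ(h
a b̂)` (`pairing_eq`, `pr_eq_tau`). Non-degeneracy follows at once, and it forces the whole
structure on `A`.

The dual comultiplication represents the bilinear map `(m, x) ↦ a(m x)`. Evaluation `a ⊗ b ↦ a(m)
b(x)` need not be injective, but for `P = ∑ (right mult. by p) ⊗ (left mult. by q)` the product `P
s` depends only on the evaluation of `s` (`P_mul_congr`). So `Δ(a) = P s` for any tensor `s`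
representing `a(m x)`; one exists because `E(m x)` is a finite sum of products of values of elements
of `A`. The axioms for `Δ` reduce to identities between bilinear maps. The counit is `T₀(a(1) h)`,
the antipode is `S(a)(m) = â(m h) z`, and `ε_t(a)` is left multiplication by `a(1)`.

The main computation is `a₁ m S(a₂) = a(m)` (`adjointEval_comul`). Invariance of `m` then says `a(m)
= a(1) m` for all `a`; for `a = e₁` this is `m = E(m) ∈ N`. -/

noncomputable section

namespace StronglySeparable

/-! ## Evaluation calculus for the centralizer `A = C_{M₁}(N)` -/

section Evaluation

variable {k N M : Type*} [Field k] [Ring N] [Algebra k N] [Ring M] [Algebra k M]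
  {ι : N →ₐ[k] M}

variable (ι) in
/-- An element of `A` as an `N`-bimodule endomorphism of `M`. -/
def ap : A ι →ₐ[k] Module.End k M := (rightEnd ι).val.comp (A ι).val

theorem ap_injective : Function.Injective (ap ι) :=
  Subtype.val_injective.comp Subtype.val_injective

theorem ap_ext {a b : A ι} (h : ∀ m, ap ι a m = ap ι b m) : a = b :=
  ap_injective (LinearMap.ext h)

theorem ap_right (a : A ι) (m : M) (n : N) : ap ι a (m * ι n) = ap ι a m * ι n :=
  (a : M₁ ι).2 m n

theorem ap_left (a : A ι) (n : N) (m : M) : ap ι a (ι n * m) = ι n * ap ι a m := by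
  have h := (Subalgebra.mem_centralizer_iff k).1 a.2 (incl₁ ι (ι n)) ⟨n, rfl⟩
  have h2 := congrArg (fun f : M₁ ι => (f : Module.End k M) m) h
  exact h2.symm

/-- The element of `A` with a given underlying bimodule endomorphism. -/
def mkA (f : M →ₗ[k] M) (hr : ∀ m n, f (m * ι n) = f m * ι n)
    (hl : ∀ n m, f (ι n * m) = ι n * f m) : A ι :=
  ⟨⟨f, hr⟩, (Subalgebra.mem_centralizer_iff k).2 (by
    rintro _ ⟨n, rfl⟩
    exact Subtype.ext (LinearMap.ext fun m => (hl n m).symm))⟩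

@[simp] theorem ap_mkA (f : M →ₗ[k] M) (hr : ∀ m n, f (m * ι n) = f m * ι n)
    (hl : ∀ n m, f (ι n * m) = ι n * f m) (m : M) : ap ι (mkA f hr hl) m = f m := rfl

theorem ap_mul (a b : A ι) (m : M) : ap ι (a * b) m = ap ι a (ap ι b m) := by
  rw [map_mul]; rfl

theorem ap_one (m : M) : ap ι 1 m = m := by
  rw [map_one]; rfl

theorem centralizer_comm (u : centralizer ι) (n : N) : ι n * (u : M) = u * ι n :=
  (Subalgebra.mem_centralizer_iff k).1 u.2 _ ⟨n, rfl⟩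

theorem mem_centralizer_of_comm {u : M} (h : ∀ n, ι n * u = u * ι n) : u ∈ centralizer ι :=
  (Subalgebra.mem_centralizer_iff k).2 (by rintro _ ⟨n, rfl⟩; exact h n)

variable (ι) in
/-- Left multiplication by an element of the centralizer. -/
def lm : centralizer ι →ₗ[k] A ι where
  toFun u := mkA (LinearMap.mulLeft k (u : M)) (fun m n => by simp [mul_assoc])
    (fun n m => by simp [← mul_assoc, centralizer_comm])
  map_add' u v := ap_ext fun m => add_mul (u : M) v m
  map_smul' c u := ap_ext fun m => smul_mul_assoc c (u : M) m

variable (ι) in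
/-- Right multiplication by an element of the centralizer. -/
def rm : centralizer ι →ₗ[k] A ι where
  toFun u := mkA (LinearMap.mulRight k (u : M)) (fun m n => by simp [mul_assoc, centralizer_comm])
    (fun n m => by simp [mul_assoc])
  map_add' u v := ap_ext fun m => mul_add m (u : M) v
  map_smul' c u := ap_ext fun m => mul_smul_comm c m (u : M)

@[simp] theorem ap_lm (u : centralizer ι) (m : M) : ap ι (lm ι u) m = u * m := rfl

@[simp] theorem ap_rm (u : centralizer ι) (m : M) : ap ι (rm ι u) m = m * u := rfl

theorem lm_mul (u v : centralizer ι) : lm ι (u * v) = lm ι u * lm ι v :=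
  ap_ext fun m => by simp [mul_assoc]

theorem rm_mul (u v : centralizer ι) : rm ι (u * v) = rm ι v * rm ι u :=
  ap_ext fun m => by simp [mul_assoc]

theorem lm_one : lm ι 1 = 1 := ap_ext fun m => by simp

theorem rm_one : rm ι 1 = 1 := ap_ext fun m => by simp

theorem lm_mul_rm (u v : centralizer ι) : lm ι u * rm ι v = rm ι v * lm ι u :=
  ap_ext fun m => by simp [mul_assoc]

theorem ap_mem_centralizer (a : A ι) (u : centralizer ι) : ap ι a u ∈ centralizer ι :=
  mem_centralizer_of_comm fun n => by rw [← ap_left, ← ap_right, centralizer_comm]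

variable (D : StronglySeparable ι)

theorem E_mul_left (s : N) (r : M) : D.E (ι s * r) = s * D.E r := by
  simpa using D.bimodule s 1 r

theorem eq_of_E_mul_right {m m' : M} (h : ∀ x, D.E (m * x) = D.E (m' * x)) : m = m' := by
  rw [← D.dual_left m, ← D.dual_left m']
  exact Finset.sum_congr rfl fun i _ => by rw [h]

theorem eq_of_E_mul_left {m m' : M} (h : ∀ x, D.E (x * m) = D.E (x * m')) : m = m' := by
  rw [← D.dual_right m, ← D.dual_right m']
  exact Finset.sum_congr rfl fun i _ => by rw [h]

/-- The adjoint of an endomorphism with respect to `E`: `E(r*(m) x) = E(m r(x))`. -/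
def adj (r : M →ₗ[k] M) : M →ₗ[k] M :=
  ∑ j, LinearMap.mulRight k (D.y j) ∘ₗ ι.toLinearMap ∘ₗ D.E ∘ₗ LinearMap.mulRight k (r (D.x j))

theorem adj_apply (r : M →ₗ[k] M) (m : M) :
    D.adj r m = ∑ j, ι (D.E (m * r (D.x j))) * D.y j := by
  simp [adj]

theorem E_adj_mul (r : M →ₗ[k] M) (hr : ∀ m n, r (m * ι n) = r m * ι n) (m x : M) :
    D.E (D.adj r m * x) = D.E (m * r x) := by
  conv_rhs => rw [← D.dual_right x]
  simp only [adj_apply, Finset.sum_mul, map_sum, Finset.mul_sum, mul_assoc, E_mul_left, hr]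
  simp only [← mul_assoc, E_mul_right]

theorem adj_eq_of_forall {r s : M →ₗ[k] M} (h : ∀ m x, D.E (s m * x) = D.E (m * r x)) :
    D.adj r = s := by
  ext m
  rw [adj_apply, ← D.dual_left (s m)]
  exact Finset.sum_congr rfl fun i _ => by rw [h]

/-- Moving an endomorphism through the dual basis tensor. -/
theorem sum_apply_mul (f g r : M →ₗ[k] M) (hf : ∀ m n, f (m * ι n) = f m * ι n)
    (hg : ∀ n m, g (ι n * m) = ι n * g m) :
    ∑ i, f (r (D.x i)) * g (D.y i) = ∑ i, f (D.x i) * g (D.adj r (D.y i)) := by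
  have h1 : ∀ i, f (r (D.x i)) * g (D.y i) =
      ∑ j, f (D.x j) * g (ι (D.E (D.y j * r (D.x i))) * D.y i) := by
    intro i
    conv_lhs => rw [← D.dual_right (r (D.x i))]
    simp only [map_sum, hf, Finset.sum_mul, hg, mul_assoc]
  simp only [h1, adj_apply, map_sum, Finset.mul_sum]
  exact Finset.sum_comm

theorem adj_mulLeft (m : M) : D.adj (LinearMap.mulLeft k m) = LinearMap.mulRight k m :=
  D.adj_eq_of_forall fun x y => by simp [mul_assoc]

/-- Left and right multiplication by `m` are adjoint, so this is centrality of the dual basis tensor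
over `N`. -/
theorem sum_mul_casimir (f g : M →ₗ[k] M) (hf : ∀ m n, f (m * ι n) = f m * ι n)
    (hg : ∀ n m, g (ι n * m) = ι n * g m) (m : M) :
    ∑ i, f (m * D.x i) * g (D.y i) = ∑ i, f (D.x i) * g (D.y i * m) := by
  simpa [adj_mulLeft] using D.sum_apply_mul f g (LinearMap.mulLeft k m) hf hg

/-- The adjoint of an element of `A`. -/
def hat : A ι →ₗ[k] A ι where
  toFun a := mkA (D.adj (ap ι a))
    (fun m n => D.eq_of_E_mul_right fun x => by
      rw [E_adj_mul _ _ (ap_right a), mul_assoc, ← ap_left, mul_assoc, E_adj_mul _ _ (ap_right a)])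
    (fun n m => by simp [adj_apply, mul_assoc, E_mul_left, Finset.mul_sum])
  map_add' a b := ap_ext fun m => by
    simp [adj_apply, mul_add, add_mul, Finset.sum_add_distrib]
  map_smul' c a := ap_ext fun m => by
    simp [adj_apply, Finset.smul_sum]

theorem ap_hat (a : A ι) : (ap ι (D.hat a) : M →ₗ[k] M) = D.adj (ap ι a) := rfl

theorem E_hat_mul (a : A ι) (m x : M) : D.E (ap ι (D.hat a) m * x) = D.E (m * ap ι a x) :=
  D.E_adj_mul (ap ι a) (ap_right a) m x

theorem hat_eq_of_forall {a b : A ι} (h : ∀ m x, D.E (ap ι b m * x) = D.E (m * ap ι a x)) :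
    D.hat a = b :=
  ap_ext fun m => D.eq_of_E_mul_right fun x => by rw [E_hat_mul, h]

theorem hat_mul (a b : A ι) : D.hat (a * b) = D.hat b * D.hat a :=
  D.hat_eq_of_forall fun m x => by simp only [ap_mul, E_hat_mul]

theorem hat_lm (u : centralizer ι) : D.hat (lm ι u) = rm ι u :=
  D.hat_eq_of_forall fun m x => by simp [mul_assoc]

/-- The symmetry of `E` over `U` enters here: without it only left multiplications are known to have
multiplications as adjoints. -/
theorem hat_rm (hsymm : D.IsSymmetric) (u : centralizer ι) : D.hat (rm ι u) = lm ι u :=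
  D.hat_eq_of_forall fun m x => by
    simp only [ap_lm, ap_rm, mul_assoc]
    rw [hsymm _ u.2, mul_assoc]

theorem sum_ap_mul (f g : M →ₗ[k] M) (hf : ∀ m n, f (m * ι n) = f m * ι n)
    (hg : ∀ n m, g (ι n * m) = ι n * g m) (a : A ι) :
    ∑ i, f (ap ι a (D.x i)) * g (D.y i) = ∑ i, f (D.x i) * g (ap ι (D.hat a) (D.y i)) :=
  D.sum_apply_mul f g (ap ι a) hf hg

/-- `a(x₁) b(y₁)`-type sums lie in the centralizer. -/
theorem sum_mem_centralizer (a b : A ι) :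
    ∑ i, ap ι a (D.x i) * ap ι b (D.y i) ∈ centralizer ι :=
  mem_centralizer_of_comm fun n => by
    have := D.sum_mul_casimir (ap ι a) (ap ι b) (ap_right a) (ap_left b) (ι n)
    simpa only [ap_left, ap_right, Finset.mul_sum, Finset.sum_mul, mul_assoc] using this

theorem sum_mem_centralizer' (a : A ι) :
    ∑ i, ap ι a (D.x i) * D.y i ∈ centralizer ι := by
  simpa only [ap_one] using D.sum_mem_centralizer a 1

/-- The restriction of `E_M` to `A`. -/
def EM : A ι →ₗ[k] centralizer ι where
  toFun a := D.lam • ⟨_, D.sum_mem_centralizer' a⟩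
  map_add' a b := Subtype.ext (by simp [add_mul, Finset.sum_add_distrib])
  map_smul' c a := Subtype.ext (by
    simp only [map_smul, LinearMap.smul_apply, smul_mul_assoc, ← Finset.smul_sum, RingHom.id_apply,
      SetLike.val_smul]
    exact smul_comm _ _ _)

theorem coe_EM (a : A ι) : (D.EM a : M) = D.lam • ∑ i, ap ι a (D.x i) * D.y i := rfl

theorem expectation_coe (a : A ι) : D.expectation (a : M₁ ι) = D.EM a :=
  D.expectation_apply _

theorem EM_mul_lm (a : A ι) (u : centralizer ι) : D.EM (lm ι u * a) = u * D.EM a :=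
  Subtype.ext (by
    simp only [coe_EM, ap_mul, ap_lm, MulMemClass.coe_mul, Finset.mul_sum, mul_assoc, mul_smul_comm])

theorem EM_lm_mul (a : A ι) (u : centralizer ι) : D.EM (a * lm ι u) = D.EM a * u := by
  refine Subtype.ext ?_
  have := D.sum_mul_casimir (ap ι a) LinearMap.id (ap_right a) (fun _ _ => rfl) u
  simp only [LinearMap.id_apply] at this
  simp only [coe_EM, ap_mul, ap_lm, MulMemClass.coe_mul, this, Finset.sum_mul, mul_assoc,
    smul_mul_assoc]

variable (T : N →ₗ[k] k)

/-- The trace `T₀ = T ∘ E` on `M`. -/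
def tr : M →ₗ[k] k := T ∘ₗ D.E

theorem tr_apply (m : M) : D.tr T m = T (D.E m) := rfl

/-- The restriction of `T₁` to `A`. -/
def tau : A ι →ₗ[k] k := D.tr T ∘ₗ (centralizer ι).val.toLinearMap ∘ₗ D.EM

theorem tau_apply (a : A ι) : D.tau T a = D.tr T (D.EM a) := rfl

theorem tau_eq (a : A ι) : D.tau T a = D.lam * ∑ i, D.tr T (ap ι a (D.x i) * D.y i) := by
  simp [tau_apply, coe_EM]

theorem T₁_apply (c : M₁ ι) :
    D.T₁ T c = D.lam * ∑ i, D.tr T ((c : Module.End k M) (D.x i) * D.y i) := by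
  change T (D.E (D.expectation c)) = _
  simp [expectation_apply, tr_apply]

theorem T₁_coe (a : A ι) : D.T₁ T (a : M₁ ι) = D.tau T a := by
  rw [tau_eq, T₁_apply]; rfl

variable {T}

theorem tr_mul_comm (hT : D.IsMarkovTrace T) (a b : M) : D.tr T (a * b) = D.tr T (b * a) :=
  hT.trace_comp a b

theorem tr_hat_mul (a : A ι) (m x : M) :
    D.tr T (ap ι (D.hat a) m * x) = D.tr T (m * ap ι a x) := by
  rw [tr_apply, E_hat_mul, tr_apply]

theorem tr_E_mul (a b : M) :
    D.tr T (ι (D.E a) * b) = D.tr T (a * ι (D.E b)) := by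
  rw [tr_apply, tr_apply, E_mul_left, E_mul_right]

/-- Expanding `d(xᵢ)` in the dual bases gives a double sum that is symmetric in `c` and `d`, since
`T₀` is a trace for which `E` is self-adjoint. -/
theorem T₁_mul_comm (hT : D.IsMarkovTrace T) (c d : M₁ ι) : D.T₁ T (c * d) = D.T₁ T (d * c) := by
  have key : ∀ c d : M₁ ι, D.T₁ T (c * d) = D.lam * ∑ i, ∑ j,
      D.tr T ((c : Module.End k M) (D.x j) * ι (D.E (D.y j * (d : Module.End k M) (D.x i))) *
        D.y i) := by
    intro c d
    rw [T₁_apply]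
    congr 1
    refine Finset.sum_congr rfl fun i _ => ?_
    rw [← map_sum, ← Finset.sum_mul, rightEnd_expand]
    rfl
  rw [key, T₁_apply]
  congr 1
  have h1 : ∀ i j, D.tr T ((c : Module.End k M) (D.x j) *
      ι (D.E (D.y j * (d : Module.End k M) (D.x i))) * D.y i) =
      D.tr T ((d : Module.End k M) (D.x i) * ι (D.E (D.y i * (c : Module.End k M) (D.x j))) *
        D.y j) := by
    intro i j
    rw [mul_assoc, D.tr_mul_comm hT, mul_assoc, D.tr_E_mul, mul_assoc,
      D.tr_mul_comm hT, mul_assoc]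
  simp only [h1]
  rw [Finset.sum_comm]
  refine Finset.sum_congr rfl fun i _ => ?_
  rw [← map_sum, ← Finset.sum_mul, rightEnd_expand]
  rfl

theorem tau_mul_comm (hT : D.IsMarkovTrace T) (a b : A ι) : D.tau T (a * b) = D.tau T (b * a) := by
  rw [← T₁_coe, ← T₁_coe]
  exact D.T₁_mul_comm hT _ _

theorem tr_sum_mul_mul (hT : D.IsMarkovTrace T) (hprod : D.HasSymmetricProduct) (u : M) :
    D.tr T (∑ i, D.x i * u * D.y i) = D.lam⁻¹ * D.tr T u := by
  have h : ∀ i, D.tr T (D.x i * u * D.y i) = D.tr T (D.y i * D.x i * u) := fun i => by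
    rw [D.tr_mul_comm hT, ← mul_assoc]
  rw [map_sum]
  simp only [h]
  rw [← map_sum, ← Finset.sum_mul, hprod.2, ← Algebra.smul_def, map_smul, smul_eq_mul]

/-- `T₁` is also given by the mirrored formula. -/
theorem tau_eq' (hT : D.IsMarkovTrace T) (hprod : D.HasSymmetricProduct) (a : A ι) :
    D.tau T a = D.lam * ∑ i, D.tr T (D.x i * ap ι a (D.y i)) := by
  rw [tau_eq]
  congr 1
  -- Both sides equal `∑ xᵢ a(yᵢ x_l) y_l`. By the symmetric product property, `T₀` of `∑ xᵢ u yᵢ`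
  -- is `λ⁻¹ T₀(u)`, which removes the outer sums.
  have key : ∑ i, D.x i * (∑ l, ap ι a (D.x l) * D.y l) * D.y i =
      ∑ l, D.x l * (∑ i, D.x i * ap ι a (D.y i)) * D.y l := by
    have h1 : ∀ i, D.x i * (∑ l, ap ι a (D.x l) * D.y l) * D.y i =
        ∑ l, D.x i * (ap ι a (D.y i * D.x l) * D.y l) := fun i => by
      have := D.sum_mul_casimir (ap ι a) LinearMap.id (ap_right a) (fun _ _ => rfl) (D.y i)
      simp only [LinearMap.id_apply] at this
      rw [← Finset.mul_sum, this, mul_assoc, Finset.sum_mul]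
      simp only [mul_assoc]
    have h2 : ∀ l, D.x l * (∑ i, D.x i * ap ι a (D.y i)) * D.y l =
        ∑ i, D.x i * (ap ι a (D.y i * D.x l) * D.y l) := fun l => by
      have := D.sum_mul_casimir LinearMap.id (ap ι a) (fun _ _ => rfl) (ap_left a) (D.x l)
      simp only [LinearMap.id_apply] at this
      simp only [← mul_assoc]
      rw [← Finset.sum_mul, ← this, Finset.mul_sum]
      simp only [mul_assoc]
    simp only [h1, h2]
    exact Finset.sum_comm
  have h := congrArg (D.tr T) key
  rw [D.tr_sum_mul_mul hT hprod, D.tr_sum_mul_mul hT hprod] at h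
  rw [← map_sum, ← map_sum]
  exact mul_left_cancel₀ (inv_ne_zero D.lam_ne_zero) h

/-- The adjoint exchanges the two formulas for `T₁`, with `a` on `xᵢ` or on `yᵢ`. -/
theorem tau_hat (hT : D.IsMarkovTrace T) (hprod : D.HasSymmetricProduct) (a : A ι) :
    D.tau T (D.hat a) = D.tau T a := by
  rw [D.tau_eq, D.tau_eq' hT hprod]
  simp only [tr_hat_mul]

/-- `∑ T₀(a(xᵢ) b̂(yᵢ)) = λ⁻¹ T₁(a b)`. -/
theorem sum_tr_ap_mul_hat (a b : A ι) :
    ∑ i, D.tr T (ap ι a (D.x i) * ap ι (D.hat b) (D.y i)) = D.lam⁻¹ * D.tau T (a * b) := by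
  have := D.sum_ap_mul (ap ι a) LinearMap.id (ap_right a) (fun _ _ => rfl) b
  simp only [LinearMap.id_apply] at this
  rw [← map_sum, ← this, tau_eq, inv_mul_cancel_left₀ D.lam_ne_zero, map_sum]
  rfl

/-- `T₁` is non-degenerate on `A`. -/
def TauNondegenerate (D : StronglySeparable ι) (T : N →ₗ[k] k) : Prop :=
  ∀ a b : A ι, (∀ c, D.tau T (a * c) = D.tau T (b * c)) → a = b

/-- In `∑ T₀(â(xᵢ) c(yᵢ))`, moving `â` through the dual bases places its adjoint on `yᵢ`, while
adjointness for `T₀` places `a` outside `c`. Hence `τ(c · (adjoint of â)) = τ(a c)`. -/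
theorem hat_hat (hT : D.IsMarkovTrace T) (hprod : D.HasSymmetricProduct)
    (hnd : D.TauNondegenerate T) (a : A ι) : D.hat (D.hat a) = a := by
  refine hnd _ _ fun c => ?_
  have h1 := D.sum_ap_mul LinearMap.id (ap ι c) (fun _ _ => rfl) (ap_left c) (D.hat a)
  have h2 : ∀ i, D.tr T (ap ι (D.hat a) (D.x i) * ap ι c (D.y i)) =
      D.tr T (D.x i * ap ι (a * c) (D.y i)) := fun i => by rw [tr_hat_mul, ap_mul]
  have h3 := congrArg (D.tr T) h1
  simp only [LinearMap.id_apply, map_sum, h2, ← ap_mul] at h3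
  rw [D.tau_mul_comm hT, D.tau_eq' hT hprod, D.tau_eq' hT hprod, h3]

end Evaluation

end StronglySeparable


/-! ## Separable algebras with a trace -/

section Separable

variable {k R : Type*} [Field k] [Semiring R] [Algebra k R]

/-- Elements of a tensor product are separated by products of separating functionals. -/
theorem TensorProduct.eq_of_forall_functional {V W β γ : Type*} [AddCommMonoid V] [Module k V]
    [AddCommMonoid W] [Module k W] (F : β → V →ₗ[k] k) (G : γ → W →ₗ[k] k)
    (hF : ∀ v v', (∀ b, F b v = F b v') → v = v') (hG : ∀ w w', (∀ c, G c w = G c w') → w = w')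
    {s s' : V ⊗[k] W} (h : ∀ b c, LinearMap.mul' k k (TensorProduct.map (F b) (G c) s) =
      LinearMap.mul' k k (TensorProduct.map (F b) (G c) s')) : s = s' := by
  let _ : AddCommGroup V := Module.addCommMonoidToAddCommGroup k
  classical
  let ℬ := Module.Basis.ofVectorSpace k V
  have h1 : ∀ b c (s : V ⊗[k] W), LinearMap.mul' k k (TensorProduct.map (F b) (G c) s) =
      F b (TensorProduct.rid k V ((G c).lTensor V s)) := by
    intro b c s
    induction s with
    | zero => simp
    | add x y hx hy => simp only [map_add, hx, hy]
    | tmul x y => simp [mul_comm]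
  have h2 : ∀ c, TensorProduct.rid k V ((G c).lTensor V s) =
      TensorProduct.rid k V ((G c).lTensor V s') :=
    fun c => hF _ _ fun b => by rw [← h1, ← h1, h]
  have h3 : ∀ i c (s : V ⊗[k] W), G c (TensorProduct.lid k W ((ℬ.coord i).rTensor W s)) =
      ℬ.coord i (TensorProduct.rid k V ((G c).lTensor V s)) := by
    intro i c s
    induction s with
    | zero => simp
    | add x y hx hy => simp only [map_add, hx, hy]
    | tmul x y => simp [mul_comm]
  have h4 : ∀ i, TensorProduct.lid k W ((ℬ.coord i).rTensor W s) =
      TensorProduct.lid k W ((ℬ.coord i).rTensor W s') :=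
    fun i => hG _ _ fun c => by rw [h3, h3, h2]
  refine (TensorProduct.equivFinsuppOfBasisLeft ℬ).injective (Finsupp.ext fun i => ?_)
  have h5 : ∀ s : V ⊗[k] W, TensorProduct.equivFinsuppOfBasisLeft ℬ s i =
      TensorProduct.lid k W ((ℬ.coord i).rTensor W s) := by
    intro s
    induction s with
    | zero => simp
    | add x y hx hy => simp only [map_add, Finsupp.add_apply, hx, hy]
    | tmul x y => simp
  rw [h5, h5, h4]

/-- A non-degenerate trace on a finite-dimensional algebra has dual bases. -/
theorem exists_dualBases_of_trace [Module.Finite k R] (t : R →ₗ[k] k)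
    (htr : ∀ a b, t (a * b) = t (b * a))
    (hnd : ∀ a b, (∀ c, t (a * c) = t (b * c)) → a = b) :
    ∃ (n : ℕ) (g g' : Fin n → R), (∀ c, ∑ l, t (c * g l) • g' l = c) ∧
      ∀ c, ∑ l, t (c * g' l) • g l = c := by
  let _ : AddCommGroup R := Module.addCommMonoidToAddCommGroup k
  let B : LinearMap.BilinForm k R := (LinearMap.mul k R).compr₂ t
  have hB : B.Nondegenerate := by
    constructor
    · intro x hx
      refine hnd _ _ fun c => ?_
      rw [zero_mul, map_zero]
      exact hx c
    · intro x hx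
      refine hnd _ _ fun c => ?_
      rw [zero_mul, map_zero, htr]
      exact hx c
  let b := Module.finBasis k R
  let b' := B.dualBasis hB b
  have h1 : ∀ c, ∑ l, t (c * b l) • b' l = c := by
    intro c
    refine Eq.trans (Finset.sum_congr rfl fun l _ => ?_) (b'.sum_repr c)
    rw [LinearMap.BilinForm.dualBasis_repr_apply]
    rfl
  refine ⟨_, b, b', h1, fun c => hnd _ _ fun d => ?_⟩
  rw [Finset.sum_mul, map_sum]
  have h2 : t (c * d) = t (c * ∑ l, t (d * b l) • b' l) := by rw [h1]
  rw [h2, Finset.mul_sum, map_sum]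
  refine Finset.sum_congr rfl fun l _ => ?_
  rw [smul_mul_assoc, mul_smul_comm, map_smul, map_smul, smul_eq_mul, smul_eq_mul, mul_comm,
    htr (b l)]

theorem TensorProduct.exists_fin_sum {V W : Type*} [AddCommMonoid V] [Module k V]
    [AddCommMonoid W] [Module k W] (f : V ⊗[k] W) :
    ∃ (n : ℕ) (p : Fin n → V) (q : Fin n → W), f = ∑ s, p s ⊗ₜ[k] q s := by
  obtain ⟨S, hS⟩ := TensorProduct.exists_finset f
  refine ⟨S.card, fun s => (S.equivFin.symm s).1.1, fun s => (S.equivFin.symm s).1.2, ?_⟩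
  rw [hS, ← Finset.sum_coe_sort]
  exact (Equiv.sum_comp S.equivFin.symm fun i : S => i.1.1 ⊗ₜ[k] i.1.2).symm

/-- A separable algebra over a field is finite-dimensional. -/
theorem IsSymmetricSeparabilityElement.finite {f : R ⊗[k] R}
    (hf : IsSymmetricSeparabilityElement k f) : Module.Finite k R := by
  let _ : AddCommGroup R := Module.addCommMonoidToAddCommGroup k
  let ℬ := Module.Basis.ofVectorSpace k R
  obtain ⟨c, hc⟩ := TensorProduct.eq_repr_basis_left ℬ f
  have hc' : f = ∑ i ∈ c.support, ℬ i ⊗ₜ[k] c i := hc.symm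
  -- Taking coefficients at a basis vector in `u f = f u` shows that the span of the second legs is
  -- a right ideal. As `f₁ f₂ = 1`, the finite spans of the two families of legs multiply to the
  -- whole algebra.
  have h1 : ∀ u i, c i * u ∈ Submodule.span k (c '' c.support) := by
    intro u i
    have h := congrArg (fun g => TensorProduct.lid k R ((ℬ.coord i).rTensor R g)) (hf.casimir u)
    rw [hc'] at h
    simp only [Finset.mul_sum, Finset.sum_mul, Algebra.TensorProduct.tmul_mul_tmul, one_mul,
      mul_one, map_sum, LinearMap.rTensor_tmul, TensorProduct.lid_tmul, Module.Basis.coord_apply,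
      Module.Basis.repr_self] at h
    have h2 : ∑ x ∈ c.support, (Finsupp.single x (1 : k)) i • (c x * u) = c i * u := by
      rw [Finset.sum_eq_single i]
      · simp
      · intro x _ hx
        rw [Finsupp.single_eq_of_ne hx.symm, zero_smul]
      · intro hi
        rw [Finsupp.notMem_support_iff.1 hi, zero_mul, smul_zero]
    rw [← h2, ← h]
    exact Submodule.sum_mem _ fun x hx =>
      Submodule.smul_mem _ _ (Submodule.subset_span ⟨x, hx, rfl⟩)
  have h3 : ∀ u, u = ∑ i ∈ c.support, ℬ i * (c i * u) := by
    intro u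
    have h := hf.mul_eq_one
    rw [hc', map_sum] at h
    simp only [LinearMap.mul'_apply] at h
    calc u = (∑ i ∈ c.support, ℬ i * c i) * u := by rw [h, one_mul]
      _ = _ := by simp only [Finset.sum_mul, mul_assoc]
  have h4 : (Submodule.span k (ℬ '' c.support)) * (Submodule.span k (c '' c.support)) = ⊤ := by
    refine eq_top_iff.2 fun u _ => ?_
    rw [h3 u]
    exact Submodule.sum_mem _ fun i hi =>
      Submodule.mul_mem_mul (Submodule.subset_span ⟨i, hi, rfl⟩) (h1 u i)
  refine Module.finite_def.2 ?_
  rw [← h4]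
  exact (Submodule.fg_span (c.support.finite_toSet.image _)).mul
    (Submodule.fg_span (c.support.finite_toSet.image _))

/-- Slicing the Casimir identity with `t` shows that the legs of `f` are `t`-dual up to the factor
`z = f₁ t(f₂)`; symmetry of `f` makes `z` central. If `P`, `Q` are `t`-dual bases, expanding the
first leg in `1 = ∑ p q` gives `1 = z ∑ Q P`, so `z` is a unit. -/
theorem IsSymmetricSeparabilityElement.exists_sum {f : R ⊗[k] R}
    (hf : IsSymmetricSeparabilityElement k f) (t : R →ₗ[k] k)
    (htr : ∀ a b, t (a * b) = t (b * a))
    (hnd : ∀ a b, (∀ c, t (a * c) = t (b * c)) → a = b) :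
    IsUnit (TensorProduct.rid k R (t.lTensor R f)) ∧
    ∃ (n : ℕ) (p q : Fin n → R), ∑ s, p s * q s = 1 ∧ ∑ s, q s * p s = 1 ∧
      ∀ u, TensorProduct.rid k R (t.lTensor R f) * u = u * TensorProduct.rid k R (t.lTensor R f) ∧
        ∑ s, t (q s * u) • p s = TensorProduct.rid k R (t.lTensor R f) * u ∧
        ∑ s, t (u * p s) • q s = TensorProduct.rid k R (t.lTensor R f) * u := by
  have := hf.finite
  set z := TensorProduct.rid k R (t.lTensor R f) with hz
  obtain ⟨n, p, q, hpq⟩ := TensorProduct.exists_fin_sum f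
  have hsym : ∑ s, q s ⊗ₜ[k] p s = ∑ s, p s ⊗ₜ[k] q s := by
    have h := hf.symm
    rw [hpq] at h
    simpa only [map_sum, TensorProduct.comm_tmul] using h
  have h1 : ∑ s, p s * q s = 1 := by
    have h := hf.mul_eq_one
    rw [hpq] at h
    simpa only [map_sum, LinearMap.mul'_apply] using h
  have h2 : ∑ s, q s * p s = 1 := by
    have h := congrArg (LinearMap.mul' k R) hsym
    simpa only [map_sum, LinearMap.mul'_apply, h1] using h
  have hz1 : z = ∑ s, t (q s) • p s := by
    rw [hz, hpq]
    simp
  have slice : ∀ χ : R →ₗ[k] k, ∑ s, χ (p s) • q s = ∑ s, χ (q s) • p s := by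
    intro χ
    have h := congrArg (fun g => TensorProduct.rid k R (χ.lTensor R g)) hsym
    simpa using h
  have cas : ∀ u, ∑ s, (u * p s) ⊗ₜ[k] q s = ∑ s, p s ⊗ₜ[k] (q s * u) := by
    intro u
    have h := hf.casimir u
    rw [hpq] at h
    simpa only [Finset.mul_sum, Finset.sum_mul, Algebra.TensorProduct.tmul_mul_tmul, one_mul,
      mul_one] using h
  have h3 : ∀ u, ∑ s, t (q s * u) • p s = u * z := by
    intro u
    have h := congrArg (fun g => TensorProduct.rid k R (t.lTensor R g)) (cas u)
    simp only [map_sum, LinearMap.lTensor_tmul, TensorProduct.rid_tmul] at h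
    rw [← h, hz1, Finset.mul_sum]
    simp only [mul_smul_comm]
  have h4 : ∀ u, ∑ s, t (u * p s) • q s = z * u := by
    intro u
    have h := congrArg (fun g => TensorProduct.lid k R (t.rTensor R g)) (cas u)
    simp only [map_sum, LinearMap.rTensor_tmul, TensorProduct.lid_tmul] at h
    rw [h, hz1, ← slice, Finset.sum_mul]
    simp only [smul_mul_assoc]
  have h5 : ∀ u, z * u = u * z := by
    intro u
    rw [← h3, ← h4]
    have h := slice (t ∘ₗ LinearMap.mulLeft k u)
    simp only [LinearMap.comp_apply, LinearMap.mulLeft_apply] at h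
    rw [h]
    simp only [htr u]
  refine ⟨?_, n, p, q, h1, h2, fun u => ⟨h5 u, by rw [h3, h5], h4 u⟩⟩
  obtain ⟨m, P, Q, hPQ, -⟩ := exists_dualBases_of_trace t htr hnd
  have h6 : z * ∑ i, Q i * P i = 1 := by
    rw [← h1]
    have h7 : ∀ s, p s * q s = ∑ i, t (p s * P i) • (Q i * q s) := by
      intro s
      conv_lhs => rw [← hPQ (p s)]
      simp only [Finset.sum_mul, smul_mul_assoc]
    simp only [h7]
    rw [Finset.sum_comm, Finset.mul_sum]
    refine Finset.sum_congr rfl fun i _ => ?_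
    simp only [← mul_smul_comm, ← Finset.mul_sum, htr _ (P i), h4]
    rw [← mul_assoc, h5, mul_assoc]
  exact ⟨⟨z, _, h6, by rw [← h5, h6]⟩, rfl⟩

/-- Kanzaki separability passes to anti-isomorphic algebras. -/
theorem IsKanzakiSeparable.of_antiEquiv {S : Type*} [Semiring S] [Algebra k S] (e : R ≃ₗ[k] S)
    (he : ∀ a b, e (a * b) = e b * e a) (h : IsKanzakiSeparable k R) :
    IsKanzakiSeparable k S := by
  obtain ⟨f, hf⟩ := h
  obtain ⟨n, p, q, hpq⟩ := TensorProduct.exists_fin_sum f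
  have hsym : ∑ s, q s ⊗ₜ[k] p s = ∑ s, p s ⊗ₜ[k] q s := by
    have h := hf.symm
    rw [hpq] at h
    simpa only [map_sum, TensorProduct.comm_tmul] using h
  have he1 : e 1 = 1 := by
    have h := he 1 (e.symm 1)
    rw [one_mul, e.apply_symm_apply, one_mul] at h
    exact h.symm
  refine ⟨∑ s, e (p s) ⊗ₜ[k] e (q s), ?_, ?_, ?_⟩
  · intro a
    obtain ⟨u, rfl⟩ := e.surjective a
    have cas : ∑ s, (u * p s) ⊗ₜ[k] q s = ∑ s, p s ⊗ₜ[k] (q s * u) := by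
      have h := hf.casimir u
      rw [hpq] at h
      simpa only [Finset.mul_sum, Finset.sum_mul, Algebra.TensorProduct.tmul_mul_tmul, one_mul,
        mul_one] using h
    -- Reversing products turns the Casimir identity of `f` into that of the flipped tensor; the
    -- symmetry of `f`, used once on each side, flips it back.
    have h1 := congrArg (fun g => TensorProduct.map e.toLinearMap e.toLinearMap
      (TensorProduct.comm k R R g)) cas
    have h2 := congrArg (fun g => TensorProduct.map (e.toLinearMap ∘ₗ LinearMap.mulRight k u)
      e.toLinearMap g) hsym
    have h3 := congrArg (fun g => TensorProduct.map e.toLinearMap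
      (e.toLinearMap ∘ₗ LinearMap.mulLeft k u) g) hsym
    simp only [map_sum, TensorProduct.comm_tmul, TensorProduct.map_tmul, LinearEquiv.coe_coe,
      LinearMap.comp_apply, LinearMap.mulRight_apply, LinearMap.mulLeft_apply, he] at h1 h2 h3
    simp only [Finset.mul_sum, Finset.sum_mul, Algebra.TensorProduct.tmul_mul_tmul, one_mul,
      mul_one]
    rw [← h2, ← h1, h3]
  · have h2 := congrArg (LinearMap.mul' k R) hsym
    have h := hf.mul_eq_one
    rw [hpq, ← hsym] at h
    simp only [map_sum, LinearMap.mul'_apply] at h ⊢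
    rw [← he1, ← h, map_sum]
    simp only [he]
  · have h := congrArg (TensorProduct.map e.toLinearMap e.toLinearMap) hsym
    simpa only [map_sum, TensorProduct.comm_tmul, TensorProduct.map_tmul,
      LinearEquiv.coe_coe] using h

theorem IsKanzakiSeparable.isSymmetricSeparabilityElement (h : IsKanzakiSeparable k R) :
    IsSymmetricSeparabilityElement k (symmetricSeparabilityElement k R) := by
  rw [symmetricSeparabilityElement, dif_pos h]
  exact h.choose_spec

end Separable


/-! ### The centralizers `U` and `V`, and dual bases of `A` over `U` and over `k` -/

namespace StronglySeparable

section DualData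

variable {k N M : Type*} [Field k] [Ring N] [Algebra k N] [Ring M] [Algebra k M]
  {ι : N →ₐ[k] M}

variable (ι) in
/-- The anti-isomorphism of `U = C_M(N)` with `V = C_{M₁}(M)`, by right multiplications. -/
def centralizerEquivV : centralizer ι ≃ₗ[k] V ι where
  toFun u := ⟨(rm ι u : M₁ ι), (Subalgebra.mem_centralizer_iff k).2 (by
    rintro _ ⟨m, rfl⟩
    exact Subtype.ext (LinearMap.ext fun x => (mul_assoc m x (u : M)).symm))⟩
  map_add' u v := Subtype.ext (congrArg (Subtype.val : A ι → M₁ ι) (map_add (rm ι) u v))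
  map_smul' c u := Subtype.ext (congrArg (Subtype.val : A ι → M₁ ι) (map_smul (rm ι) c u))
  invFun v := ⟨((v : M₁ ι) : Module.End k M) 1, mem_centralizer_of_comm fun n => by
    have h := (Subalgebra.mem_centralizer_iff k).1 v.2 (incl₁ ι (ι n)) ⟨ι n, rfl⟩
    have h2 := congrArg (fun f : M₁ ι => (f : Module.End k M) 1) h
    have h3 := (v : M₁ ι).2 1 n
    rw [one_mul] at h3
    rw [← h3]
    refine h2.trans ?_
    change ((v : M₁ ι) : Module.End k M) (ι n * 1) = _
    rw [mul_one]⟩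
  left_inv u := Subtype.ext (one_mul (u : M))
  right_inv v := Subtype.ext (Subtype.ext (LinearMap.ext fun m => by
    have h := (Subalgebra.mem_centralizer_iff k).1 v.2 (incl₁ ι m) ⟨m, rfl⟩
    have h2 := congrArg (fun f : M₁ ι => (f : Module.End k M) 1) h
    refine h2.trans ?_
    change ((v : M₁ ι) : Module.End k M) (m * 1) = _
    rw [mul_one]))

theorem coe_centralizerEquivV (u : centralizer ι) :
    (centralizerEquivV ι u : M₁ ι) = (rm ι u : M₁ ι) := rfl

theorem centralizerEquivV_mul (u v : centralizer ι) :
    centralizerEquivV ι (u * v) = centralizerEquivV ι v * centralizerEquivV ι u :=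
  Subtype.ext (congrArg (Subtype.val : A ι → M₁ ι) (rm_mul u v))

theorem centralizerEquivV_one : centralizerEquivV ι 1 = 1 :=
  Subtype.ext (congrArg (Subtype.val : A ι → M₁ ι) (rm_one (ι := ι)))

variable (D : StronglySeparable ι) (T : N →ₗ[k] k)

/-- The separability element of `U = C_M(N)` as a finite sum, together with the invertible central
element `z = f₁ T₀(f₂)` and its inverse `h`. -/
structure CentralizerData where
  r : ℕ
  p : Fin r → centralizer ι
  q : Fin r → centralizer ι
  h : centralizer ι
  z : centralizer ι
  h_mul_z : h * z = 1
  z_comm : ∀ u, z * u = u * z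
  sum_p_mul_q : ∑ s, p s * q s = 1
  sum_q_mul_p : ∑ s, q s * p s = 1
  sum_tr_smul_p : ∀ u : centralizer ι, ∑ s, D.tr T ((q s : M) * u) • p s = z * u
  sum_tr_smul_q : ∀ u : centralizer ι, ∑ s, D.tr T ((u : M) * p s) • q s = z * u
  weight_eq : (D.weight T : M₁ ι) = (rm ι h : M₁ ι)

variable {T}

/-- So `V` with the trace `T₁` is the opposite algebra of `U` with `T₀`. -/
theorem T₁_rm (hT : D.IsMarkovTrace T) (hprod : D.HasSymmetricProduct) (u : centralizer ι) :
    D.tau T (rm ι u) = D.tr T u := by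
  rw [tau_eq, ← map_sum]
  simp only [ap_rm]
  rw [D.tr_sum_mul_mul hT hprod, mul_inv_cancel_left₀ D.lam_ne_zero]

theorem tr_centralizer_ext (hirr : D.IsWeaklyIrreducible T) {a b : centralizer ι}
    (h : ∀ c : centralizer ι, D.tr T ((a : M) * c) = D.tr T ((b : M) * c)) : a = b := by
  refine sub_eq_zero.1 (Subtype.ext (hirr.2 _ (a - b).2 fun v hv => ?_))
  have := h ⟨v, hv⟩
  rw [tr_apply, tr_apply] at this
  change T (D.E (((a : M) - b) * v)) = 0
  rw [sub_mul, map_sub, map_sub, this, sub_self]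

/-- The weight is defined in `V`, whereas the calculus uses `U`. The separability data of `V` is
obtained there and pulled back along the anti-isomorphism, which is why the two orders of `p` and
`q` are exchanged. -/
theorem nonempty_centralizerData (hT : D.IsMarkovTrace T) (hprod : D.HasSymmetricProduct)
    (hirr : D.IsWeaklyIrreducible T) : Nonempty (D.CentralizerData T) := by
  let e := centralizerEquivV ι
  have hf := (hirr.1.of_antiEquiv e centralizerEquivV_mul).isSymmetricSeparabilityElement
  let t : V ι →ₗ[k] k := D.T₁ T ∘ₗ (V ι).val.toLinearMap
  have ht : ∀ u, t (e u) = D.tr T u := fun u =>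
    (D.T₁_coe T (rm ι u)).trans (D.T₁_rm hT hprod u)
  have htr : ∀ a b, t (a * b) = t (b * a) := fun a b => D.T₁_mul_comm hT a b
  have hnd : ∀ a b, (∀ c, t (a * c) = t (b * c)) → a = b := by
    intro a b hab
    obtain ⟨u, rfl⟩ := e.surjective a
    obtain ⟨v, rfl⟩ := e.surjective b
    congr 1
    refine D.tr_centralizer_ext hirr fun c => ?_
    have := hab (e c)
    simp only [e, ← centralizerEquivV_mul] at this
    rw [D.tr_mul_comm hT, D.tr_mul_comm hT (v : M)]
    exact (ht _).symm.trans (this.trans (ht _))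
  obtain ⟨hunit, r, p, q, h1, h2, h3⟩ := hf.exists_sum t htr hnd
  set z := TensorProduct.rid k (V ι) (t.lTensor (V ι) (symmetricSeparabilityElement k (V ι)))
    with hz
  have hw : D.weight T = Ring.inverse z := rfl
  have es_mul : ∀ a b, e.symm (a * b) = e.symm b * e.symm a := by
    intro a b
    refine e.injective ?_
    rw [e.apply_symm_apply]
    exact ((centralizerEquivV_mul _ _).trans (by
      change e (e.symm a) * e (e.symm b) = _
      rw [e.apply_symm_apply, e.apply_symm_apply])).symm
  have es_one : e.symm 1 = 1 := e.injective (by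
    rw [e.apply_symm_apply]; exact centralizerEquivV_one.symm)
  have es_sum : ∀ g : Fin r → V ι, e.symm (∑ s, g s) = ∑ s, e.symm (g s) :=
    fun g => map_sum e.symm.toLinearMap g Finset.univ
  have es_smul : ∀ (c : k) (a : V ι), e.symm (c • a) = c • e.symm a :=
    fun c a => e.symm.toLinearMap.map_smul c a
  have ht' : ∀ a, D.tr T (e.symm a : centralizer ι) = t a := fun a => by
    rw [← ht, e.apply_symm_apply]
  refine ⟨⟨r, fun s => e.symm (p s), fun s => e.symm (q s), e.symm (D.weight T), e.symm z,
    ?_, ?_, ?_, ?_, ?_, ?_, ?_⟩⟩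
  · rw [← es_mul, hw, Ring.mul_inverse_cancel _ hunit, es_one]
  · intro u
    obtain ⟨v, rfl⟩ := e.symm.surjective u
    rw [← es_mul, ← es_mul, (h3 v).1]
  · simp only [← es_mul]
    rw [← es_sum, h2, es_one]
  · simp only [← es_mul]
    rw [← es_sum, h1, es_one]
  · intro u
    obtain ⟨v, rfl⟩ := e.symm.surjective u
    have h4 : ∀ s, D.tr T ((e.symm (q s) : M) * (e.symm v : centralizer ι)) = t (q s * v) := by
      intro s
      rw [← MulMemClass.coe_mul, ← es_mul, ht', htr]
    simp only [h4, ← es_smul]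
    rw [← es_sum, (h3 v).2.1, (h3 v).1, es_mul]
  · intro u
    obtain ⟨v, rfl⟩ := e.symm.surjective u
    have h4 : ∀ s, D.tr T ((e.symm v : M) * (e.symm (p s) : centralizer ι)) = t (v * p s) := by
      intro s
      rw [← MulMemClass.coe_mul, ← es_mul, ht', htr]
    simp only [h4, ← es_smul]
    rw [← es_sum, (h3 v).2.2, (h3 v).1, es_mul]
  · rw [← coe_centralizerEquivV]
    exact congrArg Subtype.val (e.apply_symm_apply _).symm

/-! ### Dual bases in `A` -/

theorem basic_E : D.basic.E = D.expectation := rfl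

/-- The second identity is the dual basis expansion of `e₁ m`, evaluated at `x`: its coefficients
are `E_M(e₁ m z) = λ ẑ(m)`. -/
theorem exists_dualBases (hdepth : D.HasWeakDepthTwo) :
    ∃ (m : ℕ) (z w : Fin m → A ι), (∀ a : A ι, ∑ j, lm ι (D.EM (a * z j)) * w j = a) ∧
      ∀ m x : M, D.lam • ∑ j, ap ι (D.hat (z j)) m * ap ι (w j) x = ι (D.E (m * x)) := by
  obtain ⟨m, z, w, hz, hw, h1, -⟩ := hdepth.1
  refine ⟨m, fun j => ⟨z j, hz j⟩, fun j => ⟨w j, hw j⟩, fun a => ?_, fun m x => ?_⟩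
  · refine Subtype.ext ?_
    rw [AddSubmonoidClass.coe_finsetSum, ← h1 (a : M₁ ι)]
    refine Finset.sum_congr rfl fun j _ => ?_
    rw [basic_E]
    exact (congrArg (fun m => leftReg ι m * w j)
      (D.expectation_coe (a * (⟨z j, hz j⟩ : A ι)))).symm
  · have h2 := congrArg (fun f : M₁ ι => (f : Module.End k M) x)
      (h1 (D.jones * incl₁ ι m))
    have h3 : ((D.jones * incl₁ ι m : M₁ ι) : Module.End k M) x = ι (D.E (m * x)) := rfl
    rw [← h3, ← h2]
    rw [basic_E, AddSubmonoidClass.coe_finsetSum, LinearMap.sum_apply, Finset.smul_sum]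
    refine Finset.sum_congr rfl fun j _ => ?_
    change _ = D.expectation (D.jones * incl₁ ι m * z j) * ((w j : M₁ ι) : Module.End k M) x
    rw [expectation_apply, ap_hat, adj_apply, smul_mul_assoc]
    rfl

/-- An element `a` is recovered from its coefficients `E_M(a z) ∈ U`, and `T₀(E_M(a z) c) = τ(a z
c)` detects these because `T₀` is non-degenerate on `U`. -/
theorem tauNondegenerate (hirr : D.IsWeaklyIrreducible T) (hdepth : D.HasWeakDepthTwo) :
    D.TauNondegenerate T := by
  intro a b hab
  obtain ⟨m, z, w, h, -⟩ := D.exists_dualBases hdepth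
  rw [← h a, ← h b]
  refine Finset.sum_congr rfl fun j _ => ?_
  congr 2
  refine D.tr_centralizer_ext hirr fun c => ?_
  rw [← MulMemClass.coe_mul, ← MulMemClass.coe_mul, ← EM_lm_mul, ← EM_lm_mul, ← tau_apply,
    ← tau_apply, mul_assoc, mul_assoc, hab]

/-- `A` is finitely generated over `U` by the dual bases, and `U` is finite-dimensional because it
is separable. -/
theorem finite_A (hirr : D.IsWeaklyIrreducible T) (hdepth : D.HasWeakDepthTwo) :
    Module.Finite k (A ι) := by
  obtain ⟨m, z, w, h, -⟩ := D.exists_dualBases hdepth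
  have : Module.Finite k (centralizer ι) := hirr.1.isSymmetricSeparabilityElement.finite
  let F : (Fin m → centralizer ι) →ₗ[k] A ι :=
    ∑ j, LinearMap.mulRight k (w j) ∘ₗ lm ι ∘ₗ LinearMap.proj j
  refine Module.Finite.of_surjective F fun a => ⟨fun j => D.EM (a * z j), ?_⟩
  rw [← h a]
  simp [F, h a]

namespace CentralizerData

variable {D} (C : D.CentralizerData T)

theorem z_mul_h : C.z * C.h = 1 := by rw [C.z_comm, C.h_mul_z]

theorem h_comm (u : centralizer ι) : C.h * u = u * C.h := by
  calc C.h * u = C.h * u * (C.z * C.h) := by rw [C.z_mul_h, mul_one]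
    _ = C.h * (C.z * u) * C.h := by rw [C.z_comm u]; simp only [mul_assoc]
    _ = u * C.h := by rw [← mul_assoc C.h, C.h_mul_z, one_mul]

theorem coe_h_mul_z : (C.h : M) * C.z = 1 := congrArg Subtype.val C.h_mul_z

theorem coe_z_mul_h : (C.z : M) * C.h = 1 := congrArg Subtype.val C.z_mul_h

theorem coe_h_mul_z_mul (m : M) : (C.h : M) * (C.z * m) = m := by
  rw [← mul_assoc, coe_h_mul_z, one_mul]

theorem coe_z_mul_h_mul (m : M) : (C.z : M) * (C.h * m) = m := by
  rw [← mul_assoc, coe_z_mul_h, one_mul]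

theorem coe_z_comm {u : M} (hu : u ∈ centralizer ι) : (C.z : M) * u = u * C.z :=
  congrArg Subtype.val (C.z_comm ⟨u, hu⟩)

theorem coe_h_comm {u : M} (hu : u ∈ centralizer ι) : (C.h : M) * u = u * C.h :=
  congrArg Subtype.val (C.h_comm ⟨u, hu⟩)

theorem sum_coe_p_mul_q (m : M) : ∑ s, (C.p s : M) * (C.q s * m) = m := by
  have := congrArg Subtype.val C.sum_p_mul_q
  rw [AddSubmonoidClass.coe_finsetSum] at this
  simp only [← mul_assoc, ← Finset.sum_mul]
  exact (congrArg (· * m) this).trans (one_mul m)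

theorem sum_coe_q_mul_p (m : M) : ∑ s, (C.q s : M) * (C.p s * m) = m := by
  have := congrArg Subtype.val C.sum_q_mul_p
  rw [AddSubmonoidClass.coe_finsetSum] at this
  simp only [← mul_assoc, ← Finset.sum_mul]
  exact (congrArg (· * m) this).trans (one_mul m)

theorem sum_tr_smul_coe_p {u : M} (hu : u ∈ centralizer ι) :
    ∑ s, D.tr T ((C.q s : M) * u) • (C.p s : M) = C.z * u := by
  have := congrArg Subtype.val (C.sum_tr_smul_p ⟨u, hu⟩)
  rwa [AddSubmonoidClass.coe_finsetSum] at this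

/-- `∑ T₀(x p) T₀(q u) = T₀(x z u)` for `u` in the centralizer. -/
theorem sum_tr_mul_tr (x x' : M) {u : M} (hu : u ∈ centralizer ι) :
    ∑ s, D.tr T (x * C.p s * x') * D.tr T (C.q s * u) = D.tr T (x * (C.z * u) * x') := by
  rw [← C.sum_tr_smul_coe_p hu, Finset.mul_sum, Finset.sum_mul, map_sum]
  refine Finset.sum_congr rfl fun s _ => ?_
  rw [mul_smul_comm, smul_mul_assoc, map_smul, smul_eq_mul, mul_comm]

/-- `T₁`-dual bases of `A` decompose `E`. -/
theorem lam_smul_sum_hat_mul (hT : D.IsMarkovTrace T) (hirr : D.IsWeaklyIrreducible T)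
    (hdepth : D.HasWeakDepthTwo) {n : ℕ} {g g' : Fin n → A ι}
    (hg : ∀ c, ∑ l, D.tau T (c * g l) • g' l = c) (m x : M) :
    D.lam • ∑ l, ap ι (D.hat (g l)) m * (C.z * ap ι (g' l) x) = ι (D.E (m * x)) := by
  have hnd := D.tauNondegenerate hirr hdepth
  obtain ⟨r, zz, w, h1, h2⟩ := D.exists_dualBases hdepth
  have hg2 : ∀ X Y : A ι, ∑ l, D.tau T (X * g l) * D.tau T (g' l * Y) = D.tau T (X * Y) := by
    intro X Y
    conv_rhs => rw [← hg X, Finset.sum_mul, map_sum]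
    simp only [smul_mul_assoc, map_smul, smul_eq_mul]
  -- Bases dual for the scalar form `τ` become bases dual over `U`, at the cost of the factor `z`:
  -- the separability element joins two scalar traces into one trace with `z` inserted.
  have h3 : ∀ c : A ι, ∑ l, g l * lm ι (C.z * D.EM (g' l * c)) = c := by
    intro c
    refine hnd _ _ fun d => ?_
    rw [Finset.sum_mul, map_sum]
    have h4 : ∀ l, D.tau T (g l * lm ι (C.z * D.EM (g' l * c)) * d) =
        ∑ s, D.tau T (lm ι (C.p s) * d * g l) * D.tau T (g' l * (c * lm ι (C.q s))) := by
      intro l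
      have h5 := C.sum_tr_mul_tr (D.EM (d * g l)) 1 (D.EM (g' l * c)).2
      rw [D.tau_mul_comm hT, ← mul_assoc, tau_apply, EM_lm_mul, MulMemClass.coe_mul,
        MulMemClass.coe_mul]
      rw [mul_one] at h5
      rw [← h5]
      refine Finset.sum_congr rfl fun s _ => ?_
      rw [mul_assoc (lm ι _), D.tau_mul_comm hT (lm ι _), tau_apply, EM_lm_mul, ← mul_assoc (g' l),
        D.tau_mul_comm hT _ (lm ι _), D.tau_apply T (lm ι _ * _), EM_mul_lm, mul_one]
      rfl
    simp only [h4]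
    rw [Finset.sum_comm]
    simp only [hg2]
    have h6 : ∀ s, D.tau T (lm ι (C.p s) * d * (c * lm ι (C.q s))) =
        D.tau T (lm ι (C.q s * C.p s) * (d * c)) := fun s => by
      rw [← mul_assoc, D.tau_mul_comm hT, lm_mul]
      simp only [mul_assoc]
    simp only [h6]
    rw [← map_sum, ← Finset.sum_mul, ← map_sum, C.sum_q_mul_p, lm_one, one_mul,
      D.tau_mul_comm hT]
  rw [← h2 m x]
  congr 1
  -- Expanding `g'` in the depth two bases moves the `U`-coefficients to the other leg, where the
  -- sum over `l` collapses by `h3`.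
  have h7 : ∀ l, ap ι (D.hat (g l)) m * (C.z * ap ι (g' l) x) =
      ∑ j, ap ι (D.hat (g l * lm ι (C.z * D.EM (g' l * zz j)))) m * ap ι (w j) x := by
    intro l
    conv_lhs => rw [← h1 (g' l)]
    simp only [map_sum, LinearMap.sum_apply, Finset.mul_sum, ap_mul, hat_mul, hat_lm, ap_lm, ap_rm,
      MulMemClass.coe_mul, mul_assoc]
  simp only [h7]
  rw [Finset.sum_comm]
  refine Finset.sum_congr rfl fun j _ => ?_
  rw [← Finset.sum_mul, ← LinearMap.sum_apply, ← map_sum, ← map_sum, h3]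

end CentralizerData

end DualData

end StronglySeparable


/-! ### Coalgebras dual to associative products -/

section DualCoalgebra

variable {k H B : Type*} [Field k] [AddCommMonoid H] [Module k H] [AddCommMonoid B] [Module k B]
  {pr : H →ₗ[k] B →ₗ[k] k} {comul : H →ₗ[k] H ⊗[k] H} {conv : B → B → B}

/-- A comultiplication that is dual to an associative product under a non-degenerate pairing is
coassociative. -/
theorem coassoc_of_pairing (hpr : ∀ a a', (∀ b, pr a b = pr a' b) → a = a')
    (hassoc : ∀ b b' b'', conv (conv b b') b'' = conv b (conv b' b''))
    (hcomul : ∀ a b b', LinearMap.mul' k k (TensorProduct.map (pr.flip b) (pr.flip b') (comul a)) =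
      pr a (conv b b')) :
    TensorProduct.assoc k H H H ∘ₗ comul.rTensor H ∘ₗ comul = comul.lTensor H ∘ₗ comul := by
  ext a
  refine TensorProduct.eq_of_forall_functional (fun b => pr.flip b)
    (fun c : B × B => LinearMap.mul' k k ∘ₗ TensorProduct.map (pr.flip c.1) (pr.flip c.2)) hpr
    (fun _ _ h => TensorProduct.eq_of_forall_functional (fun b => pr.flip b)
      (fun b => pr.flip b) hpr hpr fun b b' => h (b, b')) fun b c => ?_
  obtain ⟨b', b''⟩ := c
  have h0 : ∀ (t : H ⊗[k] H) (c : H), LinearMap.mul' k k (TensorProduct.map (pr.flip b)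
      (LinearMap.mul' k k ∘ₗ TensorProduct.map (pr.flip b') (pr.flip b''))
        (TensorProduct.assoc k H H H (t ⊗ₜ c))) =
      LinearMap.mul' k k (TensorProduct.map (pr.flip b) (pr.flip b') t) * pr c b'' := by
    intro t c
    induction t with
    | zero => simp
    | add t t' h h' => simp only [TensorProduct.add_tmul, map_add, h, h', add_mul]
    | tmul x y => simp [mul_assoc]
  have h1 : ∀ s, LinearMap.mul' k k (TensorProduct.map (pr.flip b)
      (LinearMap.mul' k k ∘ₗ TensorProduct.map (pr.flip b') (pr.flip b''))
      (TensorProduct.assoc k H H H (comul.rTensor H s))) =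
      LinearMap.mul' k k (TensorProduct.map (pr.flip (conv b b')) (pr.flip b'') s) := by
    intro s
    induction s with
    | zero => simp
    | add s t hs ht => simp only [map_add, hs, ht]
    | tmul x y => rw [LinearMap.rTensor_tmul, h0, hcomul]; simp
  have h2 : ∀ s, LinearMap.mul' k k (TensorProduct.map (pr.flip b)
      (LinearMap.mul' k k ∘ₗ TensorProduct.map (pr.flip b') (pr.flip b''))
      (comul.lTensor H s)) =
      LinearMap.mul' k k (TensorProduct.map (pr.flip b) (pr.flip (conv b' b'')) s) := by
    intro s
    induction s with
    | zero => simp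
    | add s t hs ht => simp only [map_add, hs, ht]
    | tmul x y => simp [hcomul]
  change LinearMap.mul' k k (TensorProduct.map _ _ (TensorProduct.assoc k H H H
    (comul.rTensor H (comul a)))) = LinearMap.mul' k k (TensorProduct.map _ _
    (comul.lTensor H (comul a)))
  rw [h1, h2, hcomul, hcomul, hassoc]

theorem rTensor_counit_of_pairing (hpr : ∀ a a', (∀ b, pr a b = pr a' b) → a = a') {e : B}
    (he : ∀ b, conv e b = b)
    (hcomul : ∀ a b b', LinearMap.mul' k k (TensorProduct.map (pr.flip b) (pr.flip b') (comul a)) =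
      pr a (conv b b')) :
    (pr.flip e).rTensor H ∘ₗ comul = TensorProduct.mk k k H 1 := by
  ext a
  refine (TensorProduct.lid k H).injective (hpr _ _ fun b => ?_)
  have h : ∀ s, pr (TensorProduct.lid k H ((pr.flip e).rTensor H s)) b =
      LinearMap.mul' k k (TensorProduct.map (pr.flip e) (pr.flip b) s) := by
    intro s
    induction s with
    | zero => simp
    | add s t hs ht => simp only [map_add, LinearMap.add_apply, hs, ht]
    | tmul x y => simp
  rw [LinearMap.comp_apply, h, hcomul, he]
  simp

theorem lTensor_counit_of_pairing (hpr : ∀ a a', (∀ b, pr a b = pr a' b) → a = a') {e : B}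
    (he : ∀ b, conv b e = b)
    (hcomul : ∀ a b b', LinearMap.mul' k k (TensorProduct.map (pr.flip b) (pr.flip b') (comul a)) =
      pr a (conv b b')) :
    (pr.flip e).lTensor H ∘ₗ comul = (TensorProduct.mk k H k).flip 1 := by
  ext a
  refine (TensorProduct.rid k H).injective (hpr _ _ fun b => ?_)
  have h : ∀ s, pr (TensorProduct.rid k H ((pr.flip e).lTensor H s)) b =
      LinearMap.mul' k k (TensorProduct.map (pr.flip b) (pr.flip e) s) := by
    intro s
    induction s with
    | zero => simp
    | add s t hs ht => simp only [map_add, LinearMap.add_apply, hs, ht]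
    | tmul x y => simp [mul_comm]
  rw [LinearMap.comp_apply, h, hcomul, he]
  simp

end DualCoalgebra

/-! ### The weak unit axiom for `Δ(1)` -/

section ComulComulOne

variable {k H : Type*} [Field k] [Semiring H] [Algebra k H] {comul : H →ₗ[k] H ⊗[k] H}
  {r : ℕ} {p q : Fin r → H} {P : H ⊗[k] H}

theorem assoc_mul_one_tmul (P : H ⊗[k] H) (a b : H) :
    TensorProduct.assoc k H H H (P ⊗ₜ[k] 1) * (1 ⊗ₜ[k] (a ⊗ₜ[k] b)) =
      TensorProduct.assoc k H H H ((P * (1 ⊗ₜ[k] a)) ⊗ₜ[k] b) := by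
  induction P with
  | zero => simp
  | add s t hs ht => simp only [TensorProduct.add_tmul, map_add, add_mul, hs, ht]
  | tmul x y => simp

theorem one_tmul_mul_assoc (P : H ⊗[k] H) (a b : H) :
    (1 ⊗ₜ[k] (a ⊗ₜ[k] b)) * TensorProduct.assoc k H H H (P ⊗ₜ[k] 1) =
      TensorProduct.assoc k H H H (((1 ⊗ₜ[k] a) * P) ⊗ₜ[k] b) := by
  induction P with
  | zero => simp
  | add s t hs ht => simp only [TensorProduct.add_tmul, map_add, mul_add, hs, ht]
  | tmul x y => simp

/-- Applying `Δ` to the first leg gives `∑ P (1 ⊗ p) ⊗ q`, which is `(P ⊗ 1)(1 ⊗ P)` regrouped. -/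
theorem comul_comul_one_of_sum (hP : P = ∑ s, p s ⊗ₜ q s) (h1 : comul 1 = P)
    (hp : ∀ s, comul (p s) = P * (1 ⊗ₜ p s)) :
    TensorProduct.assoc k H H H (comul.rTensor H (comul 1)) =
      TensorProduct.assoc k H H H (comul 1 ⊗ₜ[k] 1) * (1 ⊗ₜ[k] comul 1) := by
  rw [h1]
  nth_rewrite 1 [hP]
  nth_rewrite 2 [hP]
  simp only [map_sum, LinearMap.rTensor_tmul, hp, TensorProduct.tmul_sum, Finset.mul_sum,
    assoc_mul_one_tmul]

theorem comul_comul_one_of_sum' (hP : P = ∑ s, p s ⊗ₜ q s) (h1 : comul 1 = P)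
    (hp : ∀ s, comul (p s) = (1 ⊗ₜ p s) * P) :
    TensorProduct.assoc k H H H (comul.rTensor H (comul 1)) =
      (1 ⊗ₜ[k] comul 1) * TensorProduct.assoc k H H H (comul 1 ⊗ₜ[k] 1) := by
  rw [h1]
  nth_rewrite 1 [hP]
  nth_rewrite 1 [hP]
  simp only [map_sum, LinearMap.rTensor_tmul, hp, TensorProduct.tmul_sum, Finset.sum_mul,
    one_tmul_mul_assoc]

end ComulComulOne

/-! ### Convolution on `A`, the product of `B` in disguise -/

namespace StronglySeparable

section Convolution

variable {k N M : Type*} [Field k] [Ring N] [Algebra k N] [Ring M] [Algebra k M]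
  {ι : N →ₐ[k] M} (D : StronglySeparable ι)

/-- The Jones idempotent as an element of `A`. -/
def jonesA : A ι := mkA (ι.toLinearMap ∘ₗ D.E) (fun m n => by simp [E_mul_right])
  (fun n m => by simp [E_mul_left])

@[simp] theorem ap_jonesA (m : M) : ap ι D.jonesA m = ι (D.E m) := rfl

/-- The map `m ↦ ∑ a(m xᵢ) b(yᵢ)`, for `a, b ∈ A`. -/
def conv (b a : A ι) : A ι :=
  mkA (∑ i, LinearMap.mulRight k (ap ι b (D.y i)) ∘ₗ ap ι a ∘ₗ LinearMap.mulRight k (D.x i))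
    (fun m n => by
      have := D.sum_mul_casimir (ap ι a ∘ₗ LinearMap.mulLeft k m) (ap ι b)
        (fun x n => by simp [← mul_assoc, ap_right]) (ap_left b) (ι n)
      simpa [← mul_assoc, ap_right, Finset.sum_mul] using this)
    (fun n m => by simp [mul_assoc, ap_left, Finset.mul_sum])

theorem ap_conv (b a : A ι) (m : M) :
    ap ι (D.conv b a) m = ∑ i, ap ι a (m * D.x i) * ap ι b (D.y i) := by
  simp [conv]

/-- Both bracketings agree after one dual basis vector is moved through the other dual basis tensor.
-/
theorem conv_assoc (a b c : A ι) : D.conv (D.conv a b) c = D.conv a (D.conv b c) := by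
  refine ap_ext fun m => ?_
  simp only [ap_conv, Finset.mul_sum, Finset.sum_mul]
  rw [Finset.sum_comm]
  refine Finset.sum_congr rfl fun i _ => ?_
  have := D.sum_mul_casimir (ap ι c ∘ₗ LinearMap.mulLeft k m) (ap ι b)
    (fun x n => by simp [← mul_assoc, ap_right]) (ap_left b) (D.x i)
  simp only [LinearMap.comp_apply, LinearMap.mulLeft_apply] at this
  simp only [← mul_assoc, ← Finset.sum_mul] at this ⊢
  rw [this]

theorem conv_jonesA (a : A ι) : D.conv a D.jonesA = a := by
  refine ap_ext fun m => ?_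
  simp only [ap_conv, ap_jonesA, ← ap_left]
  rw [← map_sum, D.dual_left]

theorem jonesA_conv (a : A ι) : D.conv D.jonesA a = a := by
  refine ap_ext fun m => ?_
  simp only [ap_conv, ap_jonesA, ← ap_right, mul_assoc]
  have := D.dual_right 1
  simp only [mul_one] at this
  rw [← map_sum, ← Finset.mul_sum, this, mul_one]

end Convolution

/-! ### The pairing on `A` and the comultiplication it determines -/

section Hopf

set_option synthInstance.maxHeartbeats 200000

variable {k N M : Type*} [Field k] [Ring N] [Algebra k N] [Ring M] [Algebra k M]
  {ι : N →ₐ[k] M}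

/-- The data from which the weak Hopf algebra structure of `A` is built: the separability element
of `U`, and `T₁`-dual bases `g`, `g'` of `A`. -/
structure HopfData (D : StronglySeparable ι) (T : N →ₗ[k] k) extends D.CentralizerData T where
  markov : D.IsMarkovTrace T
  symmetric : D.IsSymmetric
  hat_hat : ∀ a : A ι, D.hat (D.hat a) = a
  tau_hat : ∀ a : A ι, D.tau T (D.hat a) = D.tau T a
  tauNondegenerate : D.TauNondegenerate T
  n : ℕ
  g : Fin n → A ι
  g' : Fin n → A ι
  sum_hat_g : ∀ m x : M, D.lam • ∑ l, ap ι (D.hat (g l)) m * (z * ap ι (g' l) x) = ι (D.E (m * x))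
  sum_hat_g' : ∀ m x : M,
    D.lam • ∑ l, ap ι (D.hat (g' l)) m * (z * ap ι (g l) x) = ι (D.E (m * x))

theorem nonempty_hopfData {D : StronglySeparable ι} {T : N →ₗ[k] k}
    (hT : D.IsMarkovTrace T) (hsymm : D.IsSymmetric) (hprod : D.HasSymmetricProduct)
    (hirr : D.IsWeaklyIrreducible T) (hdepth : D.HasWeakDepthTwo) : Nonempty (D.HopfData T) := by
  obtain ⟨C⟩ := D.nonempty_centralizerData hT hprod hirr
  have hnd := D.tauNondegenerate hirr hdepth
  have := D.finite_A hirr hdepth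
  obtain ⟨n, g, g', h1, h2⟩ := exists_dualBases_of_trace (D.tau T) (D.tau_mul_comm hT) hnd
  exact ⟨{ C with
    markov := hT
    symmetric := hsymm
    hat_hat := D.hat_hat hT hprod hnd
    tau_hat := D.tau_hat hT hprod
    tauNondegenerate := hnd
    n := n
    g := g
    g' := g'
    sum_hat_g := C.lam_smul_sum_hat_mul hT hirr hdepth h1
    sum_hat_g' := C.lam_smul_sum_hat_mul hT hirr hdepth h2 }⟩

variable (ι) in
/-- The pairing `(a ⊗ b)(m, x) = a(m) b(x)`. -/
def ev : A ι ⊗[k] A ι →ₗ[k] M →ₗ[k] M →ₗ[k] M :=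
  TensorProduct.lift (LinearMap.mk₂ k
    (fun a b => (LinearMap.mul k M).compl₁₂ (ap ι a) (ap ι b))
    (fun a a' b => by ext; simp) (fun c a b => by ext; simp)
    (fun a b b' => by ext; simp [mul_add]) (fun c a b => by ext; simp))

@[simp] theorem ev_tmul (a b : A ι) (m x : M) : ev ι (a ⊗ₜ b) m x = ap ι a m * ap ι b x := rfl

theorem ev_mul_tmul (s : A ι ⊗[k] A ι) (a b : A ι) (m x : M) :
    ev ι (s * (a ⊗ₜ b)) m x = ev ι s (ap ι a m) (ap ι b x) := by
  induction s with
  | zero => simp only [zero_mul, LinearMap.map_zero, LinearMap.zero_apply]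
  | add s t hs ht => simp only [add_mul, map_add, LinearMap.add_apply, hs, ht]
  | tmul c d => simp only [Algebra.TensorProduct.tmul_mul_tmul, ev_tmul, ap_mul]

theorem ev_mul {s : A ι ⊗[k] A ι} {a : A ι} (hs : ∀ m x, ev ι s m x = ap ι a (m * x))
    (t : A ι ⊗[k] A ι) (m x : M) : ev ι (s * t) m x = ap ι a (ev ι t m x) := by
  induction t with
  | zero => simp only [mul_zero, LinearMap.map_zero, LinearMap.zero_apply]
  | add t t' h h' => simp only [mul_add, map_add, LinearMap.add_apply, h, h']
  | tmul c d => rw [ev_mul_tmul, hs, ev_tmul]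

namespace HopfData

variable {D : StronglySeparable ι} {T : N →ₗ[k] k} (C : D.HopfData T)

/-- The pairing `⟨a, b⟩ = ∑ T₀(a(xᵢ) b(yᵢ) h)` on `A`. -/
def pr : A ι →ₗ[k] A ι →ₗ[k] k :=
  ∑ i, ((LinearMap.mul k M).compr₂ (D.tr T ∘ₗ LinearMap.mulRight k (C.h : M))).compl₁₂
    (LinearMap.applyₗ (D.x i) ∘ₗ (ap ι).toLinearMap)
    (LinearMap.applyₗ (D.y i) ∘ₗ (ap ι).toLinearMap)

theorem pr_apply (a b : A ι) :
    C.pr a b = ∑ i, D.tr T (ap ι a (D.x i) * ap ι b (D.y i) * C.h) := by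
  simp [pr]

/-- This reduces non-degeneracy of the pairing on both sides to that of `τ`, since `h` is invertible
and `hat` is involutive. -/
theorem pr_eq_tau (a b : A ι) : C.pr a b = D.lam⁻¹ * D.tau T (lm ι C.h * a * D.hat b) := by
  rw [pr_apply, ← sum_tr_ap_mul_hat]
  refine Finset.sum_congr rfl fun i _ => ?_
  rw [C.hat_hat, D.tr_mul_comm C.markov, ap_mul, ap_lm, mul_assoc]

theorem lm_h_mul_lm_z : lm ι C.h * lm ι C.z = 1 := by rw [← lm_mul, C.h_mul_z, lm_one]

theorem lm_z_mul_lm_h : lm ι C.z * lm ι C.h = 1 := by rw [← lm_mul, C.z_mul_h, lm_one]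

theorem pr_ext_left {a a' : A ι} (h : ∀ b, C.pr a b = C.pr a' b) : a = a' := by
  have h1 : lm ι C.h * a = lm ι C.h * a' := C.tauNondegenerate _ _ fun c => by
    have := h (D.hat c)
    rw [pr_eq_tau, pr_eq_tau, C.hat_hat] at this
    exact mul_left_cancel₀ (inv_ne_zero D.lam_ne_zero) this
  rw [← one_mul a, ← one_mul a', ← C.lm_z_mul_lm_h, mul_assoc, h1, mul_assoc]

theorem pr_ext_right {b b' : A ι} (h : ∀ a, C.pr a b = C.pr a b') : b = b' := by
  have h1 : D.hat b * lm ι C.h = D.hat b' * lm ι C.h := C.tauNondegenerate _ _ fun c => by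
    have := h c
    rw [pr_eq_tau, pr_eq_tau] at this
    rw [mul_assoc, mul_assoc, D.tau_mul_comm C.markov, D.tau_mul_comm C.markov (D.hat b')]
    exact mul_left_cancel₀ (inv_ne_zero D.lam_ne_zero) this
  rw [← C.hat_hat b, ← C.hat_hat b', ← mul_one (D.hat b), ← mul_one (D.hat b'),
    ← C.lm_h_mul_lm_z, ← mul_assoc, h1, mul_assoc]

/-- The product functional `⟨·, b⟩ ⊗ ⟨·, b'⟩`. -/
def pr₂ (b b' : A ι) : A ι ⊗[k] A ι →ₗ[k] k :=
  LinearMap.mul' k k ∘ₗ TensorProduct.map (C.pr.flip b) (C.pr.flip b')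

@[simp] theorem pr₂_tmul (b b' a a' : A ι) : C.pr₂ b b' (a ⊗ₜ a') = C.pr a b * C.pr a' b' := rfl

theorem pr₂_ext {s t : A ι ⊗[k] A ι} (h : ∀ b b', C.pr₂ b b' s = C.pr₂ b b' t) : s = t :=
  TensorProduct.eq_of_forall_functional (fun b => C.pr.flip b) (fun b => C.pr.flip b)
    (fun _ _ h => C.pr_ext_left h) (fun _ _ h => C.pr_ext_left h) h

/-- The element `Δ(1)`. -/
def P : A ι ⊗[k] A ι := ∑ s, rm ι (C.p s) ⊗ₜ lm ι (C.q s)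

theorem P_mul_tmul (a b : A ι) :
    C.P * (a ⊗ₜ b) = ∑ s, (rm ι (C.p s) * a) ⊗ₜ[k] (lm ι (C.q s) * b) := by
  simp only [P, Finset.sum_mul, Algebra.TensorProduct.tmul_mul_tmul]

/-- Evaluation does not see `P`, because `∑ p q = 1` is inserted between the two values. -/
theorem ev_P_mul (s : A ι ⊗[k] A ι) (m x : M) : ev ι (C.P * s) m x = ev ι s m x := by
  induction s with
  | zero => rw [mul_zero]
  | add s t hs ht => simp only [mul_add, map_add, LinearMap.add_apply, hs, ht]
  | tmul a b =>
    rw [P_mul_tmul]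
    simp only [map_sum, LinearMap.sum_apply, ev_tmul, ap_mul, ap_rm, ap_lm, mul_assoc]
    rw [← Finset.mul_sum, C.sum_coe_p_mul_q]

/-- The two pairings contribute two factors `h`. The sum over `p ⊗ q` merges the two traces and
inserts `z`, which cancels one `h` and leaves an expression in the evaluation of `s` alone. -/
theorem pr₂_P_mul (s : A ι ⊗[k] A ι) (b b' : A ι) : C.pr₂ b b' (C.P * s) =
    ∑ j, ∑ i, D.tr T (ev ι s (D.x j) (D.x i) * ap ι b' (D.y i) * ap ι b (D.y j) * C.h) := by
  induction s with
  | zero => simp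
  | add s t hs ht =>
    simp only [mul_add, map_add, LinearMap.add_apply, add_mul, Finset.sum_add_distrib, hs, ht]
  | tmul a c =>
    rw [P_mul_tmul]
    simp only [map_sum, pr₂_tmul, pr_apply, ap_mul, ap_rm, ap_lm, ev_tmul, Finset.sum_mul]
    rw [Finset.sum_comm]
    refine Finset.sum_congr rfl fun j _ => ?_
    have hu := D.sum_mem_centralizer c b'
    have h1 := C.sum_tr_mul_tr (ap ι a (D.x j)) (ap ι b (D.y j) * C.h)
      (mul_mem hu C.h.2)
    rw [← C.coe_h_comm hu, C.coe_z_mul_h_mul, C.coe_h_comm hu] at h1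
    simp only [Finset.mul_sum, Finset.sum_mul, map_sum, mul_assoc] at h1 ⊢
    exact h1

/-- Multiplication by `P` thus selects a canonical tensor for each representable bilinear map. -/
theorem P_mul_congr {s t : A ι ⊗[k] A ι} (h : ∀ m x, ev ι s m x = ev ι t m x) :
    C.P * s = C.P * t :=
  C.pr₂_ext fun b b' => by simp only [pr₂_P_mul, h]

/-- The map `a ↦ (m ↦ ∑ a(m xᵢ) c(yᵢ) z)`. -/
def slice (c : A ι) : A ι →ₗ[k] A ι where
  toFun a := rm ι C.z * D.conv c a
  map_add' a b := ap_ext fun m => by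
    simp only [ap_mul, ap_rm, ap_conv, map_add, LinearMap.add_apply, add_mul,
      Finset.sum_add_distrib]
  map_smul' r a := ap_ext fun m => by
    simp only [ap_mul, ap_rm, ap_conv, map_smul, LinearMap.smul_apply, smul_mul_assoc,
      ← Finset.smul_sum, RingHom.id_apply]

theorem ap_slice (c a : A ι) (m : M) :
    ap ι (C.slice c a) m = ∑ i, ap ι a (m * D.x i) * (ap ι c (D.y i) * C.z) := by
  simp only [slice, LinearMap.coe_mk, AddHom.coe_mk, ap_mul, ap_rm, ap_conv, Finset.sum_mul,
    mul_assoc]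

/-- A tensor representing `(m, x) ↦ a(m x)`. -/
def preComul : A ι →ₗ[k] A ι ⊗[k] A ι :=
  D.lam • ∑ l, (TensorProduct.mk k (A ι) (A ι)).flip (C.g' l) ∘ₗ C.slice (D.hat (C.g l))

theorem preComul_apply (a : A ι) :
    C.preComul a = D.lam • ∑ l, C.slice (D.hat (C.g l)) a ⊗ₜ[k] C.g' l := by
  simp [preComul]

/-- Writing `x = ∑ xᵢ E(yᵢ x)` gives `a(m x) = ∑ a(m xᵢ) E(yᵢ x)`, and the decomposition of `E`
splits off the dependence on `x` as values of the `g'`. -/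
theorem ev_preComul (a : A ι) (m x : M) : ev ι (C.preComul a) m x = ap ι a (m * x) := by
  have h : ∀ i, ι (D.E (D.y i * x)) =
      D.lam • ∑ l, ap ι (D.hat (C.g l)) (D.y i) * (C.z * ap ι (C.g' l) x) :=
    fun i => (C.sum_hat_g _ _).symm
  conv_rhs => rw [← D.dual_right x, Finset.mul_sum, map_sum]
  simp only [← mul_assoc, ap_right]
  simp only [preComul_apply, map_smul, LinearMap.smul_apply, map_sum, LinearMap.sum_apply, ev_tmul,
    ap_slice, h, mul_smul_comm, Finset.sum_mul, ← Finset.smul_sum, Finset.mul_sum, mul_assoc]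
  rw [Finset.sum_comm]

/-- The comultiplication of `A`. -/
def comul : A ι →ₗ[k] A ι ⊗[k] A ι := LinearMap.mulLeft k C.P ∘ₗ C.preComul

theorem comul_eq (a : A ι) : C.comul a = C.P * C.preComul a := rfl

theorem ev_comul (a : A ι) (m x : M) : ev ι (C.comul a) m x = ap ι a (m * x) := by
  rw [comul_eq, ev_P_mul, ev_preComul]

theorem comul_eq_of_ev {a : A ι} {s : A ι ⊗[k] A ι}
    (h : ∀ m x, ev ι s m x = ap ι a (m * x)) : C.comul a = C.P * s :=
  C.P_mul_congr fun m x => by rw [ev_preComul]; exact (h m x).symm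

theorem pr₂_comul (a b b' : A ι) : C.pr₂ b b' (C.comul a) = C.pr a (D.conv b b') := by
  rw [comul_eq, pr₂_P_mul, pr_apply]
  simp only [ev_preComul, ap_conv, Finset.mul_sum, Finset.sum_mul, map_sum]
  rw [Finset.sum_comm (s := Finset.univ) (t := Finset.univ) (f := fun i j =>
    D.tr T (ap ι a (D.x i) * (ap ι b' (D.y i * D.x j) * ap ι b (D.y j)) * C.h))]
  refine Finset.sum_congr rfl fun j _ => ?_
  have := D.sum_mul_casimir (ap ι a) (ap ι b') (ap_right a) (ap_left b') (D.x j)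
  simp only [← mul_assoc, ← Finset.sum_mul, ← map_sum]
  rw [this]

/-- The counit of `A`. -/
def counit : A ι →ₗ[k] k :=
  D.tr T ∘ₗ LinearMap.mulRight k (C.h : M) ∘ₗ LinearMap.applyₗ 1 ∘ₗ (ap ι).toLinearMap

theorem counit_apply (a : A ι) : C.counit a = D.tr T (ap ι a 1 * C.h) := rfl

/-- By `a(1) = ∑ a(xᵢ) E(yᵢ)`, the counit is the pairing with the convolution unit. -/
theorem counit_eq (a : A ι) : C.counit a = C.pr a D.jonesA := by
  rw [pr_apply, counit_apply, ← map_sum, ← Finset.sum_mul]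
  simp only [ap_jonesA, ← ap_right]
  rw [← map_sum]
  have := D.dual_right 1
  simp only [mul_one] at this
  rw [this]

theorem comul_one : C.comul 1 = C.P := by
  rw [C.comul_eq_of_ev (s := 1), mul_one]
  intro m x
  rw [Algebra.TensorProduct.one_def, ev_tmul, ap_one, ap_one, ap_one]

/-- The tensor `s Δ(b)`, with `s` representing `a(m x)`, represents `a(b(m x))`. -/
theorem comul_mul (a b : A ι) : C.comul (a * b) = C.comul a * C.comul b := by
  rw [C.comul_eq a, mul_assoc]
  refine C.comul_eq_of_ev fun m x => ?_
  rw [ev_mul (C.ev_preComul a), ev_comul, ap_mul]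

theorem comul_rm (u : centralizer ι) : C.comul (rm ι u) = C.P * (1 ⊗ₜ rm ι u) :=
  C.comul_eq_of_ev fun m x => by simp [mul_assoc]

theorem P_mul_one_tmul_rm (u : centralizer ι) :
    C.P * (1 ⊗ₜ rm ι u) = (1 ⊗ₜ rm ι u) * C.P := by
  simp only [P, Finset.sum_mul, Finset.mul_sum, Algebra.TensorProduct.tmul_mul_tmul, one_mul,
    mul_one, lm_mul_rm]

end HopfData

end Hopf

end StronglySeparable


namespace StronglySeparable

/-! ### Counit and antipode axioms -/

section WeakHopf

set_option synthInstance.maxHeartbeats 200000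

variable {k N M : Type*} [Field k] [Ring N] [Algebra k N] [Ring M] [Algebra k M]
  {ι : N →ₐ[k] M}

variable (ι) in
/-- The evaluation `a ↦ a(1)` with values in the centralizer. -/
def evalOne : A ι →ₗ[k] centralizer ι where
  toFun a := ⟨ap ι a 1, ap_mem_centralizer a 1⟩
  map_add' a b := Subtype.ext (LinearMap.congr_fun (map_add (ap ι) a b) 1)
  map_smul' c a := Subtype.ext (LinearMap.congr_fun (map_smul (ap ι) c a) 1)

theorem coe_evalOne (a : A ι) : (evalOne ι a : M) = ap ι a 1 := rfl

namespace HopfData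

variable {D : StronglySeparable ι} {T : N →ₗ[k] k} (C : D.HopfData T)

/-- The twist by `h` cancels `z`, so `p` and `q` are honest dual bases of `U` for `T₀(· h)`. -/
theorem sum_counit_smul_p (u : centralizer ι) :
    ∑ s, D.tr T (C.q s * u * C.h) • C.p s = u := by
  have h := C.sum_tr_smul_p (u * C.h)
  rw [← C.h_comm, ← mul_assoc, C.z_mul_h, one_mul, C.h_comm] at h
  simpa only [mul_assoc, MulMemClass.coe_mul] using h

theorem sum_counit_smul_q (u : centralizer ι) :
    ∑ s, D.tr T (u * C.p s * C.h) • C.q s = u := by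
  have h := C.sum_tr_smul_q (C.h * u)
  rw [← mul_assoc, C.z_mul_h, one_mul] at h
  simpa only [mul_assoc, MulMemClass.coe_mul, D.tr_mul_comm C.markov (C.h : M)] using h

theorem sum_apply_p_mul_counit (χ : M →ₗ[k] k) (u : centralizer ι) :
    ∑ s, χ (C.p s) * D.tr T (C.q s * u * C.h) = χ u := by
  have h := congrArg (fun v : centralizer ι => χ v) (C.sum_counit_smul_p u)
  simpa [mul_comm] using h

theorem sum_counit_mul_apply_q (χ : M →ₗ[k] k) (u : centralizer ι) :
    ∑ s, D.tr T (u * C.p s * C.h) * χ (C.q s) = χ u := by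
  have h := congrArg (fun v : centralizer ι => χ v) (C.sum_counit_smul_q u)
  simpa using h

theorem counit_mul_mul (a b c : A ι) : C.counit (a * b * c) =
    LinearMap.mul' k k (TensorProduct.map (C.counit ∘ₗ LinearMap.mulLeft k a)
      (C.counit ∘ₗ LinearMap.mulRight k c) (C.comul b)) := by
  -- The duality of `p` and `q` collapses the two counits to one evaluated at `(1, c(1))`, so only
  -- the bilinear map represented by `s` matters. The companion axiom uses `(c(1), 1)`.
  have key : ∀ s, LinearMap.mul' k k (TensorProduct.map (C.counit ∘ₗ LinearMap.mulLeft k a)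
      (C.counit ∘ₗ LinearMap.mulRight k c) (C.P * s)) =
      D.tr T (ap ι a (ev ι s 1 (ap ι c 1)) * C.h) := by
    intro s
    induction s with
    | zero => simp only [mul_zero, LinearMap.map_zero, LinearMap.zero_apply, zero_mul]
    | add s t hs ht => simp only [mul_add, map_add, LinearMap.add_apply, hs, ht, add_mul]
    | tmul x y =>
      rw [P_mul_tmul, map_sum, map_sum]
      have h := C.sum_apply_p_mul_counit (D.tr T ∘ₗ LinearMap.mulRight k (C.h : M) ∘ₗ
        ap ι a ∘ₗ LinearMap.mulLeft k (ap ι x 1)) (evalOne ι (y * c))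
      simp only [LinearMap.comp_apply, LinearMap.mulLeft_apply, LinearMap.mulRight_apply,
        coe_evalOne, ap_mul] at h
      simp only [TensorProduct.map_tmul, LinearMap.mul'_apply, LinearMap.comp_apply,
        LinearMap.mulLeft_apply, LinearMap.mulRight_apply, counit_apply, ap_mul, ap_rm, ap_lm,
        ev_tmul]
      exact h
  rw [comul_eq, key, ev_preComul, one_mul, counit_apply, ap_mul, ap_mul]

theorem counit_mul_mul' (a b c : A ι) : C.counit (a * b * c) =
    LinearMap.mul' k k (TensorProduct.map (C.counit ∘ₗ LinearMap.mulRight k c)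
      (C.counit ∘ₗ LinearMap.mulLeft k a) (C.comul b)) := by
  have key : ∀ s, LinearMap.mul' k k (TensorProduct.map (C.counit ∘ₗ LinearMap.mulRight k c)
      (C.counit ∘ₗ LinearMap.mulLeft k a) (C.P * s)) =
      D.tr T (ap ι a (ev ι s (ap ι c 1) 1) * C.h) := by
    intro s
    induction s with
    | zero => simp only [mul_zero, LinearMap.map_zero, LinearMap.zero_apply, zero_mul]
    | add s t hs ht => simp only [mul_add, map_add, LinearMap.add_apply, hs, ht, add_mul]
    | tmul x y =>
      rw [P_mul_tmul, map_sum, map_sum]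
      have h := C.sum_counit_mul_apply_q (D.tr T ∘ₗ LinearMap.mulRight k (C.h : M) ∘ₗ
        ap ι a ∘ₗ LinearMap.mulRight k (ap ι y 1)) (evalOne ι (x * c))
      simp only [LinearMap.comp_apply, LinearMap.mulRight_apply, coe_evalOne, ap_mul] at h
      simp only [TensorProduct.map_tmul, LinearMap.mul'_apply, LinearMap.comp_apply,
        LinearMap.mulLeft_apply, LinearMap.mulRight_apply, counit_apply, ap_mul, ap_rm, ap_lm,
        ev_tmul]
      exact h
  rw [comul_eq, key, ev_preComul, mul_one, counit_apply, ap_mul, ap_mul]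

/-! ### The antipode -/

/-- The antipode of `A`. -/
def antipode : A ι →ₗ[k] A ι :=
  LinearMap.mulLeft k (rm ι C.z) ∘ₗ LinearMap.mulRight k (rm ι C.h) ∘ₗ D.hat

theorem antipode_apply (a : A ι) : C.antipode a = rm ι C.z * (D.hat a * rm ι C.h) := rfl

theorem ap_antipode (a : A ι) (m : M) :
    ap ι (C.antipode a) m = ap ι (D.hat a) (m * C.h) * C.z := rfl

theorem rm_h_mul_rm_z : rm ι C.h * rm ι C.z = 1 := by rw [← rm_mul, C.z_mul_h, rm_one]

theorem antipode_mul_rev (a b : A ι) : C.antipode (a * b) = C.antipode b * C.antipode a := by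
  refine ap_ext fun m => ?_
  simp only [ap_mul, ap_antipode, hat_mul]
  rw [mul_assoc (ap ι (D.hat a) (m * C.h)), C.coe_z_mul_h, mul_one]

theorem antipode_lm (u : centralizer ι) : C.antipode (lm ι u) = rm ι u := by
  refine ap_ext fun m => ?_
  rw [ap_antipode, hat_lm, ap_rm, ap_rm, mul_assoc, ← C.coe_z_comm u.2, mul_assoc,
    C.coe_h_mul_z_mul]

theorem antipode_rm (u : centralizer ι) : C.antipode (rm ι u) = lm ι u := by
  refine ap_ext fun m => ?_
  rw [ap_antipode, D.hat_rm C.symmetric, ap_lm, ap_lm, mul_assoc, mul_assoc, C.coe_h_mul_z,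
    mul_one]

/-- This is `ε_t(a)`, as `P = Δ(1)`; the source counital map computed next is a right
multiplication. -/
theorem lid_counit_P_mul (a : A ι) :
    TensorProduct.lid k (A ι) (C.counit.rTensor (A ι) (C.P * (a ⊗ₜ[k] 1))) =
      lm ι (evalOne ι a) := by
  rw [P_mul_tmul, map_sum, map_sum]
  conv_rhs => rw [← C.sum_counit_smul_q (evalOne ι a), map_sum]
  refine Finset.sum_congr rfl fun s _ => ?_
  rw [LinearMap.rTensor_tmul, TensorProduct.lid_tmul, mul_one, map_smul]
  rfl

theorem rid_counit_mul_P (a : A ι) :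
    TensorProduct.rid k (A ι) (C.counit.lTensor (A ι) ((1 ⊗ₜ[k] a) * C.P)) =
      rm ι (C.z * ⟨_, ap_mem_centralizer (D.hat a) C.h⟩) := by
  rw [← C.sum_tr_smul_p, P, Finset.mul_sum, map_sum, map_sum, map_sum]
  refine Finset.sum_congr rfl fun s _ => ?_
  rw [Algebra.TensorProduct.tmul_mul_tmul, LinearMap.lTensor_tmul, TensorProduct.rid_tmul,
    one_mul, map_smul, counit_apply, ap_mul, ap_lm, mul_one, D.tr_mul_comm C.markov,
    ← tr_hat_mul, D.tr_mul_comm C.markov]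

/-- In `S(a) b` the factor `z` of the antipode cancels the outer `h`, and the remaining `â` moves
across `E` to become `a` on `m`. -/
theorem E_mul_antipode_mul (t : A ι ⊗[k] A ι) (m x : M) :
    D.E (m * (ap ι (LinearMap.mul' k (A ι) (C.antipode.rTensor (A ι) t)) x * C.h)) =
      D.E (ev ι t m x * C.h) := by
  induction t with
  | zero => simp only [map_zero, LinearMap.zero_apply, zero_mul, mul_zero]
  | add s t hs ht => simp only [mul_add, map_add, LinearMap.add_apply, hs, ht, add_mul]
  | tmul a b =>
    rw [LinearMap.rTensor_tmul, LinearMap.mul'_apply, ap_mul, ap_antipode, mul_assoc,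
      C.coe_z_mul_h, mul_one, ← E_hat_mul, C.hat_hat, ev_tmul, mul_assoc]

theorem antipode_mul_self (a : A ι) :
    LinearMap.mul' k (A ι) (C.antipode.rTensor (A ι) (C.comul a)) =
      rm ι (C.z * ⟨_, ap_mem_centralizer (D.hat a) C.h⟩) := by
  refine ap_ext fun x => ?_
  -- With `Δ(a)` inserted, `E(a(m x) h) = E(h a(m x)) = E(â(h) m x) = E(m x â(h))`; both exchanges
  -- use the symmetry of `E` over `U`.
  have h : ap ι (LinearMap.mul' k (A ι) (C.antipode.rTensor (A ι) (C.comul a))) x * C.h =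
      x * ap ι (D.hat a) C.h := D.eq_of_E_mul_left fun m => by
    rw [E_mul_antipode_mul, ev_comul, ← C.symmetric _ C.h.2, ← E_hat_mul,
      C.symmetric _ (ap_mem_centralizer (D.hat a) C.h), mul_assoc]
  rw [ap_rm, C.z_comm]
  change _ = x * (ap ι (D.hat a) C.h * C.z)
  rw [← mul_assoc, ← h, mul_assoc, C.coe_h_mul_z, mul_one]

/-- The map `a ⊗ b ↦ ((m, x) ↦ a(m S(b)(x)))`. -/
def adjointEval : A ι ⊗[k] A ι →ₗ[k] M →ₗ[k] M →ₗ[k] M :=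
  TensorProduct.lift (LinearMap.mk₂ k
    (fun a b => ((LinearMap.mul k M).compl₂ (ap ι (C.antipode b))).compr₂ (ap ι a))
    (fun a a' b => by ext; simp) (fun c a b => by ext; simp)
    (fun a b b' => by ext; simp [mul_add]) (fun c a b => by ext; simp))

theorem adjointEval_tmul (a b : A ι) (m x : M) :
    C.adjointEval (a ⊗ₜ b) m x = ap ι a (m * ap ι (C.antipode b) x) := rfl

theorem adjointEval_P_mul_tmul (c b : A ι) (m x : M) :
    C.adjointEval (C.P * (c ⊗ₜ b)) m x =
      ∑ s, ap ι c (m * ap ι (D.hat b) (x * C.q s * C.h) * C.z) * C.p s := by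
  rw [P_mul_tmul]
  simp only [map_sum, LinearMap.sum_apply, adjointEval_tmul, antipode_mul_rev, antipode_lm, ap_mul,
    ap_rm, ap_antipode, mul_assoc]

/-- `a₁ m S(a₂) = a(m)` in `M₁`. -/
theorem adjointEval_comul (a : A ι) (m x : M) :
    C.adjointEval (C.comul a) m x = ap ι a m * x := by
  -- The factor `ĝ(yᵢ) z p` is the adjoint of `g` after left multiplication by `z p`; moving it to
  -- `xᵢ` places `g` next to the adjoint of `g'`.
  have h1 : ∀ l s, ap ι (C.slice (D.hat (C.g l)) a)
      (m * ap ι (D.hat (C.g' l)) (x * C.q s * C.h) * C.z) * C.p s =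
      ∑ i, ap ι a (m * (ap ι (D.hat (C.g' l)) (x * C.q s * C.h) *
        (C.z * ap ι (C.g l) (C.z * C.p s * D.x i)))) * D.y i := by
    intro l s
    have h := D.sum_ap_mul (ap ι a ∘ₗ LinearMap.mulLeft k
      (m * ap ι (D.hat (C.g' l)) (x * C.q s * C.h) * C.z)) LinearMap.id
      (fun x n => by simp [← mul_assoc, ap_right]) (fun _ _ => rfl)
      (C.g l * lm ι (C.z * C.p s))
    simp only [hat_mul, hat_lm, ap_mul, ap_lm, ap_rm, LinearMap.comp_apply,
      LinearMap.mulLeft_apply, LinearMap.id_apply, MulMemClass.coe_mul] at h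
    rw [ap_slice, Finset.sum_mul]
    simp only [mul_assoc] at h ⊢
    exact h.symm
  -- The sum over `l` is now the decomposition of `E` with the roles of `g` and `g'` exchanged.
  have h2 : ∀ s i, D.lam • ∑ l, ap ι (D.hat (C.g' l)) (x * C.q s * C.h) *
      (C.z * ap ι (C.g l) (C.z * C.p s * D.x i)) = ι (D.E (x * (C.q s * (C.p s * D.x i)))) := by
    intro s i
    rw [C.sum_hat_g']
    simp only [mul_assoc, C.coe_h_mul_z_mul]
  have h3 : ∀ i, ∑ s, ι (D.E (x * (C.q s * (C.p s * D.x i)))) = ι (D.E (x * D.x i)) := by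
    intro i
    rw [← map_sum, ← map_sum, ← Finset.mul_sum, C.sum_coe_q_mul_p]
  rw [comul_eq, preComul_apply, mul_smul_comm, Finset.mul_sum]
  simp only [map_smul, map_sum, LinearMap.smul_apply, LinearMap.sum_apply,
    adjointEval_P_mul_tmul, h1]
  rw [Finset.sum_comm]
  have h4 : ∀ s, D.lam • ∑ l, ∑ i, ap ι a (m * (ap ι (D.hat (C.g' l)) (x * C.q s * C.h) *
        (C.z * ap ι (C.g l) (C.z * C.p s * D.x i)))) * D.y i =
      ∑ i, ap ι a (m * ι (D.E (x * (C.q s * (C.p s * D.x i))))) * D.y i := by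
    intro s
    rw [Finset.sum_comm, Finset.smul_sum]
    refine Finset.sum_congr rfl fun i _ => ?_
    rw [← h2, ← Finset.sum_mul, ← map_sum, ← Finset.mul_sum, mul_smul_comm, map_smul,
      smul_mul_assoc]
  rw [Finset.smul_sum]
  simp only [h4]
  rw [Finset.sum_comm]
  simp only [ap_right, ← Finset.sum_mul, ← Finset.mul_sum, h3]
  simp only [mul_assoc, ← Finset.mul_sum, D.dual_left]

theorem ap_mul_antipode (t : A ι ⊗[k] A ι) (x : M) :
    ap ι (LinearMap.mul' k (A ι) (C.antipode.lTensor (A ι) t)) x = C.adjointEval t 1 x := by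
  induction t with
  | zero => simp only [map_zero, LinearMap.zero_apply]
  | add s t hs ht => simp only [map_add, LinearMap.add_apply, hs, ht]
  | tmul a b =>
    rw [LinearMap.lTensor_tmul, LinearMap.mul'_apply, ap_mul, adjointEval_tmul, one_mul]

theorem self_mul_antipode (a : A ι) :
    LinearMap.mul' k (A ι) (C.antipode.lTensor (A ι) (C.comul a)) = lm ι (evalOne ι a) :=
  ap_ext fun x => by rw [ap_mul_antipode, adjointEval_comul]; rfl

/-- As `a₂ S(a₃)` is left multiplication by `a₂(1)`, which is `S` of a right multiplication, the
whole is `S` of `m ↦ a₁(m) a₂(1) = a(m)`. -/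
theorem antipode_mul_antipode (a : A ι) :
    LinearMap.mul' k (A ι) (TensorProduct.map C.antipode
      (LinearMap.mul' k (A ι) ∘ₗ C.antipode.lTensor (A ι) ∘ₗ C.comul) (C.comul a)) =
      C.antipode a := by
  have h1 : LinearMap.mul' k (A ι) ∘ₗ C.antipode.lTensor (A ι) ∘ₗ C.comul =
      lm ι ∘ₗ evalOne ι := LinearMap.ext C.self_mul_antipode
  let W : A ι ⊗[k] A ι →ₗ[k] A ι := LinearMap.mul' k (A ι) ∘ₗ
    (TensorProduct.comm k (A ι) (A ι)).toLinearMap ∘ₗ (rm ι ∘ₗ evalOne ι).lTensor (A ι)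
  have hW : ∀ t m, ap ι (W t) m = ev ι t m 1 := by
    intro t m
    induction t with
    | zero => simp only [map_zero, LinearMap.zero_apply]
    | add s t hs ht => simp only [map_add, LinearMap.add_apply, hs, ht]
    | tmul a b => rfl
  have h2 : ∀ t, LinearMap.mul' k (A ι) (TensorProduct.map C.antipode (lm ι ∘ₗ evalOne ι) t) =
      C.antipode (W t) := by
    intro t
    induction t with
    | zero => simp only [LinearMap.map_zero]
    | add s t hs ht => simp only [map_add, hs, ht]
    | tmul a b =>
      change C.antipode a * lm ι (evalOne ι b) = C.antipode (rm ι (evalOne ι b) * a)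
      rw [antipode_mul_rev, antipode_rm]
  rw [h1, h2]
  congr 1
  exact ap_ext fun m => by rw [hW, ev_comul, mul_one]

/-- The weak Hopf algebra structure of `A`. -/
@[reducible] def weakHopfAlgebra : WeakHopfAlgebra k (A ι) where
  comul := C.comul
  counit := C.counit
  coassoc := coassoc_of_pairing (fun _ _ h => C.pr_ext_left h) D.conv_assoc C.pr₂_comul
  rTensor_counit_comp_comul := by
    rw [show C.counit = C.pr.flip D.jonesA from LinearMap.ext C.counit_eq]
    exact rTensor_counit_of_pairing (fun _ _ h => C.pr_ext_left h) D.jonesA_conv C.pr₂_comul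
  lTensor_counit_comp_comul := by
    rw [show C.counit = C.pr.flip D.jonesA from LinearMap.ext C.counit_eq]
    exact lTensor_counit_of_pairing (fun _ _ h => C.pr_ext_left h) D.conv_jonesA C.pr₂_comul
  comul_mul := C.comul_mul
  counit_mul_mul := C.counit_mul_mul
  counit_mul_mul' := C.counit_mul_mul'
  comul_comul_one := comul_comul_one_of_sum rfl C.comul_one fun s => C.comul_rm (C.p s)
  comul_comul_one' := comul_comul_one_of_sum' rfl C.comul_one fun s => by
    rw [C.comul_rm, C.P_mul_one_tmul_rm]; rfl
  antipode := C.antipode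
  mul_antipode a := by rw [self_mul_antipode, comul_one, lid_counit_P_mul]
  antipode_mul a := by rw [antipode_mul_self, comul_one, rid_counit_mul_P]
  antipode_mul_antipode := C.antipode_mul_antipode

end HopfData

end WeakHopf

end StronglySeparable


/-- All other fields are propositions. -/
theorem WeakHopfAlgebra.eq_of_eq {k H : Type*} [Field k] [Semiring H] [Algebra k H]
    {W W' : WeakHopfAlgebra k H}
    (hcomul : W.toCoalgebra.comul = W'.toCoalgebra.comul)
    (hcounit : W.toCoalgebra.counit = W'.toCoalgebra.counit)
    (hantipode : W.antipode = W'.antipode) : W = W' := by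
  have h : W.toCoalgebra = W'.toCoalgebra := by
    generalize W.toCoalgebra = c at hcomul hcounit
    generalize W'.toCoalgebra = c' at hcomul hcounit
    rcases c with @⟨⟨comul, counit⟩, coassoc, rTensor, lTensor⟩
    rcases c' with @⟨⟨comul', counit'⟩, coassoc', rTensor', lTensor'⟩
    change comul = comul' at hcomul
    change counit = counit' at hcounit
    subst hcomul hcounit
    rfl
  cases W
  cases W'
  subst h hantipode
  rfl

/-! ### Identification of `B` with `A`, translation of the pairing, and uniqueness -/

namespace StronglySeparable

section SecondCentralizer

set_option synthInstance.maxHeartbeats 200000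

variable {k N M : Type*} [Field k] [Ring N] [Algebra k N] [Ring M] [Algebra k M]
  {ι : N →ₐ[k] M} (D : StronglySeparable ι)

theorem B_apply_mul (b : B ι) (c : M₁ ι) (m : M) :
    ((b : M₂ ι) : Module.End k (M₁ ι)) (c * incl₁ ι m) =
      ((b : M₂ ι) : Module.End k (M₁ ι)) c * incl₁ ι m :=
  (b : M₂ ι).2 c m

theorem B_apply_mul_left (b : B ι) (m : M) (c : M₁ ι) :
    ((b : M₂ ι) : Module.End k (M₁ ι)) (incl₁ ι m * c) =
      incl₁ ι m * ((b : M₂ ι) : Module.End k (M₁ ι)) c := by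
  have h := (Subalgebra.mem_centralizer_iff k).1 b.2 (incl₂ ι (incl₁ ι m)) ⟨m, rfl⟩
  exact (congrArg (fun f : M₂ ι => (f : Module.End k (M₁ ι)) c) h).symm

theorem jones_mul_incl (n : N) : D.jones * incl₁ ι (ι n) = incl₁ ι (ι n) * D.jones :=
  Subtype.ext (LinearMap.ext fun m => by
    change ι (D.E (ι n * m)) = ι n * ι (D.E m)
    rw [E_mul_left, map_mul])

theorem sum_incl_mul_jones_mul (c : M₁ ι) :
    ∑ i, incl₁ ι ((c : Module.End k M) (D.x i)) * D.jones * incl₁ ι (D.y i) = c := by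
  refine Subtype.ext (LinearMap.ext fun m => ?_)
  rw [AddSubmonoidClass.coe_finsetSum, LinearMap.sum_apply, ← D.rightEnd_expand c m]
  rfl

/-- The map `B → A`, `b ↦ b(e₁)`. -/
def bhat : B ι →ₗ[k] A ι where
  toFun b := ⟨((b : M₂ ι) : Module.End k (M₁ ι)) D.jones,
    (Subalgebra.mem_centralizer_iff k).2 (by
      rintro _ ⟨n, rfl⟩
      have h1 := B_apply_mul b D.jones (ι n)
      rw [jones_mul_incl, B_apply_mul_left] at h1
      exact h1)⟩
  map_add' _ _ := rfl
  map_smul' _ _ := rfl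

theorem coe_bhat (b : B ι) :
    (D.bhat b : M₁ ι) = ((b : M₂ ι) : Module.End k (M₁ ι)) D.jones := rfl

/-- Elements of `B` are `M`-bimodule maps, and `M₁ = M e₁ M`, so the value at `e₁` determines
everything. -/
theorem B_apply (b : B ι) (c : M₁ ι) : ((b : M₂ ι) : Module.End k (M₁ ι)) c =
    ∑ i, incl₁ ι ((c : Module.End k M) (D.x i)) * (D.bhat b : M₁ ι) * incl₁ ι (D.y i) := by
  conv_lhs => rw [← D.sum_incl_mul_jones_mul c, map_sum]
  refine Finset.sum_congr rfl fun i _ => ?_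
  rw [B_apply_mul, B_apply_mul_left, coe_bhat]

theorem B_apply_apply (b : B ι) (c : M₁ ι) (m : M) :
    ((((b : M₂ ι) : Module.End k (M₁ ι)) c : M₁ ι) : Module.End k M) m =
      ∑ i, (c : Module.End k M) (D.x i) * ap ι (D.bhat b) (D.y i * m) := by
  rw [D.B_apply, AddSubmonoidClass.coe_finsetSum, LinearMap.sum_apply]
  rfl

/-- The endomorphism `c ↦ ∑ c(xᵢ) a yᵢ` of `M₁`. -/
def bmap (a : A ι) : Module.End k (M₁ ι) :=
  ∑ i, LinearMap.mulRight k ((a : M₁ ι) * incl₁ ι (D.y i)) ∘ₗ (incl₁ ι).toLinearMap ∘ₗ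
    LinearMap.applyₗ (D.x i) ∘ₗ (rightEnd ι).val.toLinearMap

theorem bmap_apply_apply (a : A ι) (c : M₁ ι) (m : M) :
    (D.bmap a c : Module.End k M) m =
      ∑ i, (c : Module.End k M) (D.x i) * ap ι a (D.y i * m) := by
  rw [bmap, LinearMap.sum_apply, AddSubmonoidClass.coe_finsetSum, LinearMap.sum_apply]
  rfl

/-- The element of `B` with `b(e₁) = a`. -/
def ofBhat (a : A ι) : B ι :=
  ⟨⟨D.bmap a, fun c m => by
    refine Subtype.ext (LinearMap.ext fun x => ?_)
    refine (D.bmap_apply_apply a _ x).trans (Eq.trans ?_ (D.bmap_apply_apply a c (m * x)).symm)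
    have h := D.sum_mul_casimir (c : Module.End k M) (ap ι a ∘ₗ LinearMap.mulRight k x) c.2
      (fun n m => by simp [mul_assoc, ap_left]) m
    simp only [LinearMap.comp_apply, LinearMap.mulRight_apply, mul_assoc] at h
    exact h⟩,
  (Subalgebra.mem_centralizer_iff k).2 (by
    rintro _ ⟨m, rfl⟩
    refine Subtype.ext (LinearMap.ext fun c => Subtype.ext (LinearMap.ext fun x => ?_))
    refine Eq.trans ?_ (D.bmap_apply_apply a (incl₁ ι m * c) x).symm
    refine (congrArg (m * ·) (D.bmap_apply_apply a c x)).trans ?_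
    rw [Finset.mul_sum]
    exact Finset.sum_congr rfl fun i _ => (mul_assoc _ _ _).symm)⟩

theorem bhat_ofBhat (a : A ι) : D.bhat (D.ofBhat a) = a := by
  refine ap_ext fun m => ?_
  refine (D.bmap_apply_apply a D.jones m).trans ?_
  have h := D.dual_left 1
  simp only [one_mul] at h
  simp only [jones_apply, ← ap_left, ← mul_assoc]
  rw [← map_sum, ← Finset.sum_mul, h, one_mul]

theorem bhat_injective : Function.Injective D.bhat := by
  intro b b' h
  refine Subtype.ext (Subtype.ext (LinearMap.ext fun c => ?_))
  rw [D.B_apply, D.B_apply, h]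

/-- The linear isomorphism `B ≃ A`, `b ↦ b(e₁)`. -/
def bhatEquiv : B ι ≃ₗ[k] A ι :=
  LinearEquiv.ofBijective D.bhat ⟨D.bhat_injective, fun a => ⟨_, D.bhat_ofBhat a⟩⟩

theorem bhat_mul (b b' : B ι) : D.bhat (b * b') = D.conv (D.bhat b) (D.bhat b') := by
  refine ap_ext fun m => ?_
  refine (D.B_apply_apply b (D.bhat b' : M₁ ι) m).trans ?_
  rw [ap_conv]
  have h := D.sum_mul_casimir (ap ι (D.bhat b')) (ap ι (D.bhat b)) (ap_right _) (ap_left _) m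
  exact h.symm

theorem bhat_one : D.bhat 1 = D.jonesA := rfl

variable (T : N →ₗ[k] k)

theorem T₁_mul_jones_mul (c : M₁ ι) (m y : M) :
    D.T₁ T (c * incl₁ ι m * (D.jones * incl₁ ι y)) =
      D.lam * D.tr T ((c : Module.End k M) m * y) := by
  rw [T₁_apply, ← map_sum]
  have h : ∀ i, ((c * incl₁ ι m * (D.jones * incl₁ ι y) : M₁ ι) : Module.End k M) (D.x i) =
      (c : Module.End k M) m * ι (D.E (y * D.x i)) := fun i => c.2 _ _
  simp only [h]
  simp only [mul_assoc]
  rw [← Finset.mul_sum, D.dual_left]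

/-- The factor `λ` in the expectation cancels the `λ⁻¹` in the dual bases `λ⁻¹ xᵢ e₁`, `e₁ yᵢ`. -/
theorem T₂_apply (F : M₂ ι) : D.T₂ T F = ∑ i, D.T₁ T
    ((F : Module.End k (M₁ ι)) (incl₁ ι (D.x i) * D.jones) * (D.jones * incl₁ ι (D.y i))) := by
  have h : D.T₂ T F = D.T₁ T (D.basic.expectation F) := rfl
  rw [h, expectation_apply]
  change D.T₁ T (D.lam • ∑ i, (F : Module.End k (M₁ ι)) (D.lam⁻¹ • (incl₁ ι (D.x i) * D.jones)) *
    (D.jones * incl₁ ι (D.y i))) = _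
  simp only [map_smul, smul_mul_assoc]
  rw [← Finset.smul_sum, map_smul, smul_smul, mul_inv_cancel₀ D.lam_ne_zero, one_smul, map_sum]

theorem expectation_mul_incl_mul_jones (c : M₁ ι) (x : M) :
    D.expectation (c * (incl₁ ι x * D.jones)) = D.lam • (c : Module.End k M) x := by
  rw [expectation_apply]
  have h : ∀ i, ((c * (incl₁ ι x * D.jones) : M₁ ι) : Module.End k M) (D.x i) =
      (c : Module.End k M) x * ι (D.E (D.x i)) := fun i => c.2 _ _
  have h1 := D.dual_left 1
  simp only [one_mul] at h1
  simp only [h, mul_assoc]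
  rw [← Finset.mul_sum, h1, mul_one]

namespace HopfData

variable {D} {T} (C : D.HopfData T)

theorem pairing_eq (a : A ι) (b : B ι) : D.pairing T a b = C.pr a (D.bhat b) := by
  have h1 : ∀ i, D.T₁ T (((incl₂ ι (a : M₁ ι) * D.e₂ * D.e₁ * D.w T * (b : M₂ ι) : M₂ ι) :
      Module.End k (M₁ ι)) (incl₁ ι (D.x i) * D.jones) * (D.jones * incl₁ ι (D.y i))) =
      D.lam * (D.lam * ∑ j, D.tr T (ι (D.E (D.x i * (ap ι (D.bhat b) (D.x j) * C.h))) *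
        (ap ι a (D.y j) * D.y i))) := by
    intro i
    have h2 : ((incl₂ ι (a : M₁ ι) * D.e₂ * D.e₁ * D.w T * (b : M₂ ι) : M₂ ι) :
        Module.End k (M₁ ι)) (incl₁ ι (D.x i) * D.jones) = (a : M₁ ι) * incl₁ ι (D.expectation
          (D.jones * ((rm ι C.h : M₁ ι) * (incl₁ ι (D.x i) * (D.bhat b : M₁ ι))))) := by
      rw [← C.weight_eq, coe_bhat, ← B_apply_mul_left]
      rfl
    rw [h2, T₁_mul_jones_mul]
    congr 1
    rw [expectation_apply]
    have h3 : ∀ j, ((D.jones * ((rm ι C.h : M₁ ι) * (incl₁ ι (D.x i) * (D.bhat b : M₁ ι))) :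
        M₁ ι) : Module.End k M) (D.x j) =
        ι (D.E (D.x i * ap ι (D.bhat b) (D.x j) * C.h)) := fun j => rfl
    simp only [h3]
    change D.tr T (ap ι a _ * _) = _
    simp only [map_smul, map_sum, smul_mul_assoc, Finset.sum_mul, ap_left, smul_eq_mul, mul_assoc]
  rw [pairing_apply, T₂_apply]
  simp only [h1]
  rw [← Finset.mul_sum, ← Finset.mul_sum, ← mul_assoc, ← mul_assoc, sq]
  rw [show D.lam⁻¹ * D.lam⁻¹ * D.lam * D.lam = 1 by
    have := D.lam_ne_zero
    field_simp, one_mul, pr_apply]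
  -- The sum over `j` is the dual basis expansion of `â(yᵢ)`; afterwards `â` is moved back to `a` on
  -- `xᵢ`.
  have h4 : ∀ i, ∑ j, D.tr T (ι (D.E (D.x i * (ap ι (D.bhat b) (D.x j) * C.h))) *
        (ap ι a (D.y j) * D.y i)) =
      D.tr T (D.x i * (ap ι (D.bhat b) (ap ι (D.hat a) (D.y i)) * C.h)) := by
    intro i
    conv_rhs => rw [← D.dual_right (ap ι (D.hat a) (D.y i)), map_sum, Finset.sum_mul,
      Finset.mul_sum, map_sum]
    refine Finset.sum_congr rfl fun j _ => ?_
    rw [tr_E_mul, ap_right, ← E_hat_mul, C.hat_hat]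
    simp only [mul_assoc]
    rw [← centralizer_comm]
  simp only [h4]
  have h5 := D.sum_ap_mul LinearMap.id (LinearMap.mulRight k (C.h : M) ∘ₗ ap ι (D.bhat b))
    (fun _ _ => rfl) (fun n m => by simp [ap_left, mul_assoc]) a
  rw [← map_sum, ← map_sum]
  simp only [LinearMap.id_apply, LinearMap.comp_apply, LinearMap.mulRight_apply] at h5
  rw [← h5]
  simp only [mul_assoc]

theorem antipode_pairing_eq (a : A ι) (b : B ι) :
    D.lam⁻¹ ^ 2 * D.T₂ T ((b : M₂ ι) * D.e₁ * D.e₂ * D.w T * incl₂ ι (a : M₁ ι)) =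
      D.lam⁻¹ * D.tau T (D.bhat b * rm ι C.h * a) := by
  have h1 : ∀ i, D.T₁ T ((((b : M₂ ι) * D.e₁ * D.e₂ * D.w T * incl₂ ι (a : M₁ ι) : M₂ ι) :
      Module.End k (M₁ ι)) (incl₁ ι (D.x i) * D.jones) * (D.jones * incl₁ ι (D.y i))) =
      D.lam * (D.lam * D.tr T (ap ι (D.bhat b * rm ι C.h * a) (D.x i) * D.y i)) := by
    intro i
    have h2 : (((b : M₂ ι) * D.e₁ * D.e₂ * D.w T * incl₂ ι (a : M₁ ι) : M₂ ι) :
        Module.End k (M₁ ι)) (incl₁ ι (D.x i) * D.jones) = (D.bhat b : M₁ ι) * incl₁ ι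
          (D.expectation ((rm ι C.h : M₁ ι) * (a : M₁ ι) * (incl₁ ι (D.x i) * D.jones))) := by
      rw [← C.weight_eq, coe_bhat, ← B_apply_mul, mul_assoc (D.weight T : M₁ ι)]
      rfl
    rw [h2, T₁_mul_jones_mul, expectation_mul_incl_mul_jones, map_smul, smul_mul_assoc, map_smul,
      smul_eq_mul]
    rfl
  rw [T₂_apply]
  simp only [h1]
  rw [← Finset.mul_sum, ← Finset.mul_sum, tau_eq, sq]
  have := D.lam_ne_zero
  field_simp

/-- The defining relation of the antipode of `B` compares two values of `τ(· a)` for all `a`, so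
non-degeneracy of `τ` solves for it. -/
theorem bhat_antipodeB {S : B ι →ₗ[k] B ι} (hS : D.IsAntipodeB T S) (b : B ι) :
    D.bhat (S b) = D.hat (D.bhat b) * (lm ι C.h * rm ι C.z) := by
  have h : D.bhat (S b) * rm ι C.h = D.hat (D.bhat b) * lm ι C.h :=
    C.tauNondegenerate _ _ fun a => by
      have h1 := hS a b
      rw [C.antipode_pairing_eq, C.pairing_eq, pr_eq_tau] at h1
      rw [← mul_left_cancel₀ (inv_ne_zero D.lam_ne_zero) h1, D.tau_mul_comm C.markov, ← mul_assoc]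
  rw [← mul_assoc, ← h, mul_assoc, C.rm_h_mul_rm_z, mul_one]

/-- The antipode of `B`. -/
def antipodeB : B ι →ₗ[k] B ι :=
  D.bhatEquiv.symm.toLinearMap ∘ₗ LinearMap.mulRight k (lm ι C.h * rm ι C.z) ∘ₗ D.hat ∘ₗ D.bhat

theorem bhat_antipodeB_apply (b : B ι) :
    D.bhat (C.antipodeB b) = D.hat (D.bhat b) * (lm ι C.h * rm ι C.z) :=
  D.bhatEquiv.apply_symm_apply _

theorem isAntipodeB : D.IsAntipodeB T C.antipodeB := by
  intro a b
  have h : D.bhat (C.antipodeB b) * rm ι C.h = D.hat (D.bhat b) * lm ι C.h := by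
    rw [bhat_antipodeB_apply, mul_assoc, mul_assoc, ← rm_mul, C.h_mul_z, rm_one, mul_one]
  rw [C.antipode_pairing_eq, C.pairing_eq, pr_eq_tau, h, D.tau_mul_comm C.markov, ← mul_assoc]

/-- Rewriting both sides through `τ`, the invariance of `τ` under `hat` matches them up to cyclic
order; the factors `z` and `h` in the antipode are the ones this requires. -/
theorem pr_antipode (a b : A ι) :
    C.pr (C.antipode a) b = C.pr a (D.hat b * (lm ι C.h * rm ι C.z)) := by
  rw [pr_eq_tau, pr_eq_tau, hat_mul, hat_mul, D.hat_rm C.symmetric, hat_lm, C.hat_hat,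
    ← C.tau_hat (lm ι C.h * a * _), hat_mul, hat_mul, hat_mul, hat_mul, hat_lm, hat_lm,
    D.hat_rm C.symmetric, antipode_apply, D.tau_mul_comm C.markov]
  simp only [mul_assoc]

theorem pairing_mul (a : A ι) (b b' : B ι) :
    D.pairing T a (b * b') = C.pr₂ (D.bhat b) (D.bhat b') (C.comul a) := by
  rw [pr₂_comul, C.pairing_eq, bhat_mul]

theorem pairing_flip (b : B ι) : (D.pairing T).flip b = C.pr.flip (D.bhat b) :=
  LinearMap.ext fun a => C.pairing_eq a b

theorem pairing_nondegenerate (C : D.HopfData T) : (D.pairing T).Nondegenerate := by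
  constructor
  · intro a ha
    refine C.pr_ext_left fun b => ?_
    rw [← D.bhat_ofBhat b, ← C.pairing_eq, ha, LinearMap.map_zero, LinearMap.zero_apply]
  · intro b hb
    refine D.bhat_injective (C.pr_ext_right fun a => ?_)
    rw [← C.pairing_eq, hb, LinearMap.map_zero, LinearMap.map_zero]

theorem isDualStructure : D.IsDualStructure T C.weakHopfAlgebra where
  comul a b b' := by
    rw [C.pairing_mul, C.pairing_flip, C.pairing_flip]
    rfl
  counit a := by
    rw [C.pairing_eq, bhat_one, ← C.counit_eq]
    rfl
  antipode := ⟨C.antipodeB, C.isAntipodeB, fun a b => by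
    rw [C.pairing_eq, C.pairing_eq, bhat_antipodeB_apply, ← C.pr_antipode]
    rfl⟩

/-- The three duality relations, tested on all of `A ≅ B`, determine `Δ`, `ε` and `S` by
non-degeneracy. The antipode of `B` in the third is itself determined. -/
theorem eq_weakHopfAlgebra (H : WeakHopfAlgebra k (A ι)) (hH : D.IsDualStructure T H) :
    H = C.weakHopfAlgebra := by
  refine WeakHopfAlgebra.eq_of_eq ?_ ?_ ?_
  · refine LinearMap.ext fun a => C.pr₂_ext fun b b' => ?_
    have h := hH.comul a (D.ofBhat b) (D.ofBhat b')
    rw [C.pairing_mul, C.pairing_flip, C.pairing_flip, bhat_ofBhat, bhat_ofBhat] at h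
    exact h.symm
  · refine LinearMap.ext fun a => (hH.counit a).trans ?_
    rw [C.pairing_eq, bhat_one, ← C.counit_eq]
    rfl
  · obtain ⟨S, hS, h⟩ := hH.antipode
    refine LinearMap.ext fun a => C.pr_ext_left fun b => ?_
    have h1 := h a (D.ofBhat b)
    rw [C.pairing_eq, C.pairing_eq, C.bhat_antipodeB hS, ← C.pr_antipode, bhat_ofBhat] at h1
    exact h1

/-! ### The action on `M` -/

theorem targetCounit_eq (a : A ι) :
    @WeakHopfAlgebra.targetCounit k (A ι) _ _ _ C.weakHopfAlgebra a = lm ι (evalOne ι a) := by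
  rw [← C.lid_counit_P_mul, ← C.comul_one]
  rfl

theorem adjointAct_eq (a : A ι) (m : M) :
    @adjointAct k N M _ _ _ _ _ ι C.weakHopfAlgebra a m = incl₁ ι (ap ι a m) := by
  refine Subtype.ext (LinearMap.ext fun x => ?_)
  have h : ∀ t : A ι ⊗[k] A ι, ((LinearMap.mul' k (M₁ ι) (TensorProduct.map
      (LinearMap.mulRight k (incl₁ ι m : M₁ ι) ∘ₗ (A ι).val.toLinearMap)
      ((A ι).val.toLinearMap ∘ₗ C.antipode) t) : M₁ ι) : Module.End k M) x = C.adjointEval t m x := by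
    intro t
    induction t with
    | zero => simp only [LinearMap.map_zero, LinearMap.zero_apply]; rfl
    | add s t hs ht => simp only [map_add, LinearMap.add_apply, ← hs, ← ht]; rfl
    | tmul a b => rfl
  exact (h _).trans (C.adjointEval_comul a m x)

/-- For evaluation, multiplicativity is exactly the property that `Δ(a)` represents `(m, x) ↦ a(m
x)`. -/
theorem isModuleAlgebra :
    @WeakHopfAlgebra.IsModuleAlgebra k (A ι) _ _ _ C.weakHopfAlgebra M _ _
      (ap ι).toLinearMap :=
  letI := C.weakHopfAlgebra
  { one_act := fun m => ap_one (ι := ι) m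
    mul_act := fun a b m => ap_mul (ι := ι) a b m
    act_mul := fun a m x => by
      have h : ∀ t : A ι ⊗[k] A ι, ev ι t m x = LinearMap.mul' k M (TensorProduct.map
          ((ap ι).toLinearMap.flip m) ((ap ι).toLinearMap.flip x) t) := by
        intro t
        induction t with
        | zero => simp only [LinearMap.map_zero, LinearMap.zero_apply]
        | add s t hs ht => simp only [map_add, LinearMap.add_apply, hs, ht]
        | tmul a b => rfl
      exact (C.ev_comul a m x).symm.trans (h _)
    act_one := fun a => by
      rw [C.targetCounit_eq]
      exact (mul_one _).symm }

theorem range_eq_invariants : (ι.range : Set M) =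
    @WeakHopfAlgebra.invariants k (A ι) _ _ _ C.weakHopfAlgebra M _ _ (ap ι).toLinearMap := by
  ext m
  constructor
  · rintro ⟨n, rfl⟩ a
    rw [C.targetCounit_eq]
    change ap ι a (ι n) = ap ι a 1 * ι n
    rw [← ap_right, one_mul]
  · intro h
    -- Testing invariance on `e₁` alone suffices, since `e₁(m) = E(m)` and `e₁(1) = 1`.
    have h1 := h D.jonesA
    rw [C.targetCounit_eq] at h1
    change ι (D.E m) = ι (D.E 1) * m at h1
    rw [D.E_one, map_one, one_mul] at h1
    exact ⟨_, h1⟩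

end HopfData

end SecondCentralizer

end StronglySeparable

end

theorem mainTheorem1 {k N M : Type*} [Field k] [Ring N] [Algebra k N] [Ring M] [Algebra k M]
    (ι : N →ₐ[k] M) (D : StronglySeparable ι) (T : N →ₗ[k] k)
    (hT : D.IsMarkovTrace T) (hsymm : D.IsSymmetric) (hprod : D.HasSymmetricProduct)
    (hirr : D.IsWeaklyIrreducible T) (hdepth : D.HasWeakDepthTwo) :
    (D.pairing T).Nondegenerate ∧
    ∃ H : WeakHopfAlgebra k (StronglySeparable.A ι),
      D.IsDualStructure T H ∧
      (∀ H' : WeakHopfAlgebra k (StronglySeparable.A ι), D.IsDualStructure T H' → H' = H) ∧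
      ∃ act : StronglySeparable.A ι →ₗ[k] M →ₗ[k] M,
        (∀ (a : StronglySeparable.A ι) (m : M),
          StronglySeparable.incl₁ ι (act a m) = StronglySeparable.adjointAct ι a m) ∧
        WeakHopfAlgebra.IsModuleAlgebra act ∧
        (ι.range : Set M) = WeakHopfAlgebra.invariants act := by
  obtain ⟨C⟩ := StronglySeparable.nonempty_hopfData hT hsymm hprod hirr hdepth
  exact ⟨C.pairing_nondegenerate, C.weakHopfAlgebra, C.isDualStructure, C.eq_weakHopfAlgebra,
    (StronglySeparable.ap ι).toLinearMap, fun a m => (C.adjointAct_eq a m).symm,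
    C.isModuleAlgebra, C.range_eq_invariants⟩
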